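/- Let $\zeta$ be a transcendental real number. For an integer $m\ge 1$ let $\lambda_m(\zeta)$ (respectively $\widehat{\lambda}_m(\zeta)$) be the supremum in $[-\infty,\infty]$ of all real $\lambda$ such that the system $$1\le |x|\le X,\qquad \max_{1\le i\le m}|\zeta^i x-y_i|\le X^{-\lambda}$$ has a solution $(x,y_1,\dots,y_m)\in\mathbb{Z}^{m+1}$ for arbitrarily large real $X$ (respectively for all sufficiently large real $X$). Then for every integer $n\ge 1$ $$\widehat{\lambda}_{2n}(\zeta)\le \sqrt{\Bigl(n+\frac{1}{2n}\Bigr)^2-\frac1n}-n+\frac{1}{2n}.$$ Moreover, if $\lambda_{2n}(\zeta)>\frac1n$, then $\widehat{\lambda}_{2n}(\zeta)\le\frac{1}{n+1}$, which is a stronger bound, since $\frac{1}{n+1}<\sqrt{(n+\frac{1}{2n})^2-\frac1n}-n+\frac{1}{2n}$ for every $n\geq 1$. In particular (the cases $n=1$ and $n=2$), $\widehat{\lambda}_2(\zeta)\le\frac{\sqrt5-1}{2}$ and $\widehat{\lambda}_4(\zeta)\le\frac{\sqrt{73}-7}{4}$. -/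

import Mathlib

open Filter

/-- The system `1 ≤ |x| ≤ X`, `max_{1 ≤ i ≤ m} |ζ ^ i * x - y_i| ≤ X ^ (-l)` has a solution
`(x, y_1, …, y_m)` in integers; the integer `y_{i+1}` is stored as `y i`. -/
def SimApproxSolvable (m : ℕ) (ζ l X : ℝ) : Prop :=
  ∃ (x : ℤ) (y : Fin m → ℤ), 1 ≤ |(x : ℝ)| ∧ |(x : ℝ)| ≤ X ∧
    ∀ i : Fin m, |ζ ^ ((i : ℕ) + 1) * (x : ℝ) - (y i : ℝ)| ≤ X ^ (-l)

/-- The ordinary exponent `λ_m(ζ) ∈ [-∞, ∞]`: the supremum of the real numbers `l` such that the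
system is solvable for arbitrarily large real `X`. -/
noncomputable def lambdaExp (m : ℕ) (ζ : ℝ) : EReal :=
  sSup {e : EReal | ∃ l : ℝ, e = (l : EReal) ∧ ∃ᶠ X : ℝ in atTop, SimApproxSolvable m ζ l X}

/-- The uniform exponent `λ̂_m(ζ) ∈ [-∞, ∞]`: the supremum of the real numbers `l` such that the
system is solvable for all sufficiently large real `X`. -/
noncomputable def lambdaHatExp (m : ℕ) (ζ : ℝ) : EReal :=
  sSup {e : EReal | ∃ l : ℝ, e = (l : EReal) ∧ ∀ᶠ X : ℝ in atTop, SimApproxSolvable m ζ l X}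

/-!
Write `L q` for the sup norm distance of `(q, ζ * q, …, ζ ^ m * q)` to the nearest integer point `x q`, where
`m = 2 * n`, and let `q 0 < q 1 < …` be the denominators at which `L` reaches a new minimum. If the
uniform exponent exceeds `μ`, then `L (q k) ≤ q (k + 1) ^ (-μ)` for all large `k`
(`IsRecordSeq.eventually_le_rpow`). Both bounds rest on the following fact, and the first one also
on a comparison of the heights of rational subspaces.

*Hankel determinants.* If `μ > 1 / (n + 1)`, then for large `k` the coordinates of `x (q k)` satisfy
no linear recurrence of order at most `n` (`IsRecordSeq.eventually_not_annihilates`). Such a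
recurrence is a polynomial `G` of degree at most `n` which annihilates the point, and `ζ` is nearly
a root of it. Taken minimal, `G` divides the polynomial of degree at most `n + 1` that Dirichlet's
theorem provides for the scale `q k`; multiplicativity of the Mahler measure makes the height of `G` so
small that `G` annihilates `x (q (k - 1))` too. Going down to a fixed index leaves finitely many `G`,
none of which can be that small at `ζ`. Hence the Hankel determinant of `x (q k)` is a nonzero
integer, so `1 ≤ C * q k * L (q k) ^ n` (`IsRecordSeq.exists_one_le_mul`). This contradicts an
ordinary exponent above `1 / n`, which proves the conditional bound `1 / (n + 1)`, and in general it
bounds the growth of the denominators: `q (k + 1) ^ (n * μ) ≤ C * q k`.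

*Heights.* The logarithmic height of rational subspaces is submodular up to a constant. Let `U k` be
the plane spanned by `x (q k)` and `x (q (k + 1))`; its height is at most
`C * q (k + 1) * L (q k) ≤ C * q (k + 1) ^ (1 - μ)`. All tails of the sequence `U` span the whole
space, as `ζ` is transcendental, and a concavity argument (`exists_le_sup_of_submodular`) shows that
infinitely often `U k ≠ U (k + 1)` and the logarithmic height of `U k ⊔ U (k + 1)` is at least
`(m - 2) / (m - 1)` times the smaller one of those of `U k` and `U (k + 1)`, up to a constant.
Submodularity for these two planes, which meet in the line of `x (q (k + 1))`, then gives
`q (k + 1) ≤ C * (q (k + 1) ^ (1 / (m - 1)) * q (k + 2)) ^ (1 - μ)`. Together with the bound for the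
growth of the denominators this is a quadratic inequality for `μ`
(`IsRecordSeq.quadratic_le`), whose positive root is the first bound.
-/

/-! ### A concavity lemma for chains of subspaces -/

open Module in
/-- Let `h` be submodular and nonnegative on the whole space, and let `U` be a sequence of
`d`-dimensional subspaces, each meeting the next one in codimension at most one, all of whose tails
span the whole space, of dimension `d + 1 + e`. Then for some `k` with `U k ≠ U (k + 1)` the value
of `h` at `U k ⊔ U (k + 1)` is at least `e / (e + 1)` times the smaller of the values at `U k` and
`U (k + 1)`: this is the inequality that linear interpolation between dimension `d` and the full
dimension suggests. The induction on `e` passes to the sequence of the joins of `U k` with the next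
subspace that differs from it. -/
theorem exists_le_sup_of_submodular {K E : Type*} [Field K] [AddCommGroup E] [Module K E]
    [FiniteDimensional K E] (h : Submodule K E → ℝ) (htop : 0 ≤ h ⊤)
    (hsub : ∀ A B : Submodule K E, finrank K A = finrank K B →
      finrank K A = finrank K (A ⊓ B : Submodule K E) + 1 → h (A ⊓ B) + h (A ⊔ B) ≤ h A + h B)
    (e : ℕ) : ∀ (d : ℕ) (U : ℕ → Submodule K E), d + 1 + e = finrank K E →
      (∀ k, finrank K (U k) = d) →
      (∀ k, finrank K (U k ⊔ U (k + 1) : Submodule K E) ≤ d + 1) →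
      (∀ j, ⨆ k, U (k + j) = ⊤) →
      ∃ k, U k ≠ U (k + 1) ∧
        (e : ℝ) / (e + 1) * min (h (U k)) (h (U (k + 1))) ≤ h (U k ⊔ U (k + 1)) := by
  induction e with
  | zero =>
    intro d U hd hU hadj hspan
    obtain ⟨k, hk⟩ : ∃ k, U k ≠ U (k + 1) := by
      by_contra! hcon
      have hc : ∀ k, U k = U 0 := fun k => by
        induction k with
        | zero => rfl
        | succ k ih => rw [← hcon k, ih]
      have h1 : (⨆ k, U (k + 0)) = U 0 := by simp [hc]
      rw [hspan 0] at h1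
      have := hU 0
      rw [← h1, finrank_top] at this
      omega
    refine ⟨k, hk, ?_⟩
    have hlt : finrank K (U k) < finrank K (U k ⊔ U (k + 1) : Submodule K E) := by
      apply Submodule.finrank_lt_finrank_of_lt
      refine lt_of_le_of_ne le_sup_left fun heq => hk ?_
      have : U (k + 1) ≤ U k := by rw [heq]; exact le_sup_right
      exact (Submodule.eq_of_le_of_finrank_eq this (by rw [hU, hU])).symm
    have htop' : U k ⊔ U (k + 1) = ⊤ := by
      apply Submodule.eq_top_of_finrank_eq
      have := Submodule.finrank_le (U k ⊔ U (k + 1))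
      rw [hU] at hlt
      omega
    rw [htop']
    simpa using htop
  | succ e ih =>
    intro d U hd hU hadj hspan
    have hne : ∀ k, ∃ j, k < j ∧ U j ≠ U k := by
      intro k
      by_contra! hcon
      have hc : ∀ j, U (j + (k + 1)) = U k := fun j => hcon _ (by omega)
      have h1 : (⨆ j, U (j + (k + 1))) = U k := by simp [hc]
      rw [hspan] at h1
      have := hU k
      rw [← h1, finrank_top] at this
      omega
    classical
    set nx : ℕ → ℕ := fun k => Nat.find (hne k) with hnx
    have nx_gt : ∀ k, k < nx k := fun k => (Nat.find_spec (hne k)).1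
    have nx_ne : ∀ k, U (nx k) ≠ U k := fun k => (Nat.find_spec (hne k)).2
    have nx_between : ∀ k j, k ≤ j → j < nx k → U j = U k := by
      intro k j hkj hj
      rcases hkj.eq_or_lt with rfl | hlt
      · rfl
      · have := Nat.find_min (hne k) hj
        by_contra hx
        exact this ⟨hlt, hx⟩
    have nx_eq : ∀ k, U k = U (k + 1) → nx k = nx (k + 1) := by
      intro k hk
      have h1 : k + 1 < nx k := by
        refine lt_of_le_of_ne (nx_gt k) fun hx => nx_ne k ?_
        rw [← hx, hk]
      refine le_antisymm ?_ ?_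
      · refine Nat.find_min' _ ⟨?_, ?_⟩
        · have := nx_gt (k + 1); omega
        · rw [hk]; exact nx_ne (k + 1)
      · refine Nat.find_min' _ ⟨h1, ?_⟩
        rw [← hk]; exact nx_ne k
    have nx_succ : ∀ k, U k ≠ U (k + 1) → nx k = k + 1 := fun k hk =>
      le_antisymm (Nat.find_min' _ ⟨by omega, hk.symm⟩) (nx_gt k)
    -- the step of `U` at which the change from `U k` happens
    have pred : ∀ k, ∃ j, nx k = j + 1 ∧ k ≤ j ∧ U j = U k := by
      intro k
      have h1 := nx_gt k
      exact ⟨nx k - 1, by omega, by omega, nx_between k _ (by omega) (by omega)⟩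
    have strict : ∀ k, finrank K (U k ⊔ U (nx k) : Submodule K E) = d + 1 := by
      intro k
      obtain ⟨j, hj, -, hjk⟩ := pred k
      refine le_antisymm ?_ ?_
      · rw [hj, ← hjk]; exact hadj j
      · have : finrank K (U k) < finrank K (U k ⊔ U (nx k) : Submodule K E) := by
          apply Submodule.finrank_lt_finrank_of_lt
          refine lt_of_le_of_ne le_sup_left fun heq => nx_ne k ?_
          have : U (nx k) ≤ U k := by rw [heq]; exact le_sup_right
          exact (Submodule.eq_of_le_of_finrank_eq this (by rw [hU, hU]))
        rw [hU] at this
        exact this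
    set W : ℕ → Submodule K E := fun k => U k ⊔ U (nx k) with hW
    have hWle : ∀ k, U (k + 1) ≤ W k := by
      intro k
      by_cases hk : U k = U (k + 1)
      · rw [← hk]; exact le_sup_left
      · rw [hW]; simp only; rw [nx_succ k hk]; exact le_sup_right
    have hWsub : ∀ k, finrank K (W k) + finrank K (W (k + 1)) =
        finrank K (W k ⊔ W (k + 1) : Submodule K E) +
          finrank K (W k ⊓ W (k + 1) : Submodule K E) := fun k =>
      (Submodule.finrank_sup_add_finrank_inf_eq _ _).symm
    have hinf : ∀ k, U (k + 1) ≤ W k ⊓ W (k + 1) := fun k => le_inf (hWle k) le_sup_left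
    have hinfd : ∀ k, d ≤ finrank K (W k ⊓ W (k + 1) : Submodule K E) := fun k => by
      rw [← hU (k + 1)]; exact Submodule.finrank_mono (hinf k)
    obtain ⟨k, hWk, hk⟩ := ih (d + 1) W (by omega) strict
      (fun k => by have h1 := hWsub k; rw [strict, strict] at h1; have := hinfd k; omega)
      (fun j => by
        rw [eq_top_iff, ← hspan j]
        exact iSup_mono fun k => le_sup_left)
    have hUk : U k ≠ U (k + 1) := fun hx => hWk (by
      simp only [hW]; rw [nx_eq k hx, hx])
    have hdim : finrank K (W k ⊓ W (k + 1) : Submodule K E) = d := by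
      refine le_antisymm ?_ (hinfd k)
      have : finrank K (W k ⊓ W (k + 1) : Submodule K E) < finrank K (W k) := by
        apply Submodule.finrank_lt_finrank_of_lt
        refine lt_of_le_of_ne inf_le_left fun heq => hWk ?_
        exact Submodule.eq_of_le_of_finrank_eq (inf_eq_left.1 heq) (by rw [strict, strict])
      rw [strict] at this
      omega
    have hinfeq : W k ⊓ W (k + 1) = U (k + 1) :=
      (Submodule.eq_of_le_of_finrank_eq (hinf k) (by rw [hdim, hU])).symm
    have hs := hsub (W k) (W (k + 1)) (by rw [strict, strict]) (by rw [hdim, strict])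
    rw [hinfeq] at hs
    by_contra! hcon
    have hcast : ((e + 1 : ℕ) : ℝ) = (e : ℝ) + 1 := by push_cast; ring
    set a := ((e + 1 : ℕ) : ℝ) / ((e + 1 : ℕ) + 1) with ha
    have ha0 : 0 < a := by positivity
    -- both neighbouring joins lie below `a * h (U (k + 1))`
    have h1 : h (W k) < a * h (U (k + 1)) := by
      have := hcon k hUk
      simp only [hW]
      rw [nx_succ k hUk]
      exact this.trans_le (mul_le_mul_of_nonneg_left (min_le_right _ _) ha0.le)
    have h2 : h (W (k + 1)) < a * h (U (k + 1)) := by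
      obtain ⟨j, hj, -, hjk⟩ := pred (k + 1)
      have hjne : U j ≠ U (j + 1) := by
        rw [← hj, hjk]; exact (nx_ne (k + 1)).symm
      have := hcon j hjne
      simp only [hW]
      rw [hj, ← hjk]
      exact this.trans_le (mul_le_mul_of_nonneg_left (min_le_left _ _) ha0.le)
    set u := h (U (k + 1))
    have hb : (e : ℝ) / (e + 1) = 1 - 1 / (e + 1) := by field_simp; ring
    have hmain : u < a * u * (1 + 1 / ((e : ℝ) + 1)) := by
      have hpos : (0 : ℝ) < 1 / ((e : ℝ) + 1) := by positivity
      rw [hb] at hk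
      rcases min_cases (h (W k)) (h (W (k + 1))) with ⟨hm, -⟩ | ⟨hm, -⟩ <;> rw [hm] at hk <;>
        nlinarith
    have : a * (1 + 1 / ((e : ℝ) + 1)) = 1 := by
      rw [ha, hcast]; field_simp
    have h3 : a * u * (1 + 1 / ((e : ℝ) + 1)) = u := by
      calc _ = (a * (1 + 1 / ((e : ℝ) + 1))) * u := by ring
        _ = u := by rw [this, one_mul]
    linarith

/-! ### Heights of rational subspaces, by counting integer points -/

/-- An integer vector as a rational vector. -/
def toRat {ι : Type*} (z : ι → ℤ) : ι → ℚ := fun i => (z i : ℚ)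

/-- The integer points of sup norm at most `T` in a rational subspace `V`. -/
def intPoints {ι : Type*} (V : Submodule ℚ (ι → ℚ)) (T : ℕ) : Set (ι → ℤ) :=
  {z | toRat z ∈ V ∧ ∀ i, |z i| ≤ T}

theorem toRat_add {ι : Type*} (z w : ι → ℤ) : toRat (z + w) = toRat z + toRat w := by
  ext i; simp [toRat]

theorem toRat_sub {ι : Type*} (z w : ι → ℤ) : toRat (z - w) = toRat z - toRat w := by
  ext i; simp [toRat]

theorem toRat_smul {ι : Type*} (a : ℤ) (z : ι → ℤ) : toRat (a • z) = (a : ℚ) • toRat z := by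
  ext i; simp [toRat]

theorem toRat_injective {ι : Type*} : Function.Injective (toRat (ι := ι)) := fun z w h => by
  ext i
  have := congrFun h i
  simpa [toRat] using this

theorem finite_intPoints {ι : Type*} [Finite ι] (V : Submodule ℚ (ι → ℚ)) (T : ℕ) :
    (intPoints V T).Finite := by
  have : (Set.univ.pi fun _ : ι => Set.Icc (-(T : ℤ)) T).Finite :=
    Set.Finite.pi fun _ => Set.finite_Icc _ _
  refine this.subset fun z hz => ?_
  simp only [Set.mem_pi, Set.mem_univ, true_imp_iff, Set.mem_Icc]
  exact fun i => abs_le.1 (hz.2 i)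

/-- The integer points of a rational subspace have a `ℤ`-basis whose size is the dimension. -/
theorem exists_lattice_basis {ι : Type*} [Finite ι] (V : Submodule ℚ (ι → ℚ)) :
    ∃ b : Fin (Module.finrank ℚ V) → ι → ℤ, LinearIndependent ℚ (fun j => toRat (b j)) ∧
      ∀ z : ι → ℤ, toRat z ∈ V ↔ ∃ t : Fin (Module.finrank ℚ V) → ℤ, z = ∑ j, t j • b j := by
  classical
  have := Fintype.ofFinite ι
  let Λ : Submodule ℤ (ι → ℤ) :=
    { carrier := {z | toRat z ∈ V}
      add_mem' := fun {z w} hz hw => by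
        simp only [Set.mem_ofPred_eq] at *; rw [toRat_add]; exact V.add_mem hz hw
      zero_mem' := by
        have : toRat (0 : ι → ℤ) = 0 := by ext i; simp [toRat]
        simp only [Set.mem_ofPred_eq]; rw [this]; exact V.zero_mem
      smul_mem' := fun a z hz => by
        simp only [Set.mem_ofPred_eq] at *; rw [toRat_smul]; exact V.smul_mem _ hz }
  let B := Module.finBasis ℤ Λ
  set d' := Module.finrank ℤ Λ
  let b : Fin d' → ι → ℤ := fun j => (B j : ι → ℤ)
  have hrep : ∀ z : ι → ℤ, toRat z ∈ V ↔ ∃ t : Fin d' → ℤ, z = ∑ j, t j • b j := by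
    intro z
    constructor
    · intro hz
      refine ⟨fun j => B.repr ⟨z, hz⟩ j, ?_⟩
      have := congrArg (Subtype.val) (B.sum_repr ⟨z, hz⟩)
      rw [Submodule.coe_sum] at this
      exact this.symm
    · rintro ⟨t, rfl⟩
      have h : ∑ j, t j • b j = ((∑ j, t j • B j : Λ) : ι → ℤ) := by simp [b]
      rw [h]
      exact (∑ j, t j • B j : Λ).2
  have hliZ : LinearIndependent ℤ (fun j => toRat (b j)) := by
    have h1 : LinearIndependent ℤ b := B.linearIndependent.map' Λ.subtype (by simp)
    rw [Fintype.linearIndependent_iff] at h1 ⊢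
    intro g hg
    apply h1 g
    apply toRat_injective
    have : toRat (∑ j, g j • b j) = ∑ j, g j • toRat (b j) := by
      ext i; simp [toRat]
    rw [this, hg]; ext i; simp [toRat]
  have hli : LinearIndependent ℚ (fun j => toRat (b j)) :=
    (LinearIndependent.iff_fractionRing ℤ ℚ).1 hliZ
  have hspan : Submodule.span ℚ (Set.range fun j => toRat (b j)) = V := by
    apply le_antisymm
    · rw [Submodule.span_le]
      rintro _ ⟨j, rfl⟩
      exact (B j).2
    · intro v hv
      -- clear denominators
      obtain ⟨c, hc⟩ := IsLocalization.exist_integer_multiples_of_finite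
        (nonZeroDivisors ℤ) (S := ℚ) v
      choose z hz using hc
      have hc0 : ((c : ℤ) : ℚ) ≠ 0 := by
        exact_mod_cast nonZeroDivisors.ne_zero c.2
      have hzv : toRat z = ((c : ℤ) : ℚ) • v := by
        ext i
        have := hz i
        simpa [toRat] using this
      have hzV : toRat z ∈ V := by rw [hzv]; exact V.smul_mem _ hv
      obtain ⟨t, ht⟩ := (hrep z).1 hzV
      have hv' : v = ((c : ℤ) : ℚ)⁻¹ • toRat z := by
        rw [hzv, smul_smul, inv_mul_cancel₀ hc0, one_smul]
      rw [hv']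
      apply Submodule.smul_mem
      have : toRat z = ∑ j, (t j : ℚ) • toRat (b j) := by
        rw [ht]; ext i; simp [toRat]
      rw [this]
      exact Submodule.sum_mem _ fun j _ => Submodule.smul_mem _ _
        (Submodule.subset_span ⟨j, rfl⟩)
  have hd : d' = Module.finrank ℚ V := by
    rw [← hspan, finrank_span_eq_card hli, Fintype.card_fin]
  rw [← hd]
  exact ⟨b, hli, hrep⟩

open MeasureTheory Pointwise in
/-- The number of integer points of sup norm at most `T` in a `d`-dimensional rational subspace is
asymptotically proportional to `T ^ d`. -/
theorem exists_tendsto_intPoints {ι : Type*} [Finite ι] (V : Submodule ℚ (ι → ℚ)) :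
    ∃ κ : ℝ, 0 < κ ∧ Tendsto
      (fun T : ℕ => ((intPoints V T).ncard : ℝ) / (T : ℝ) ^ Module.finrank ℚ V) atTop (nhds κ) := by
  classical
  have := Fintype.ofFinite ι
  have hex := exists_lattice_basis V
  generalize Module.finrank ℚ V = d at hex ⊢
  obtain ⟨b, hli, hrep⟩ := hex
  let A : Matrix (Fin d) ι ℚ := Matrix.of fun j => toRat (b j)
  -- a right inverse of the matrix of the basis, which bounds coordinates in terms of the vector
  obtain ⟨B, hB⟩ : ∃ B : Matrix ι (Fin d) ℚ, A * B = 1 := by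
    have h1 : LinearMap.ker (Matrix.vecMulLinear A) = ⊥ := by
      rw [LinearMap.ker_eq_bot]
      exact Matrix.vecMul_injective_iff.2 hli
    obtain ⟨g, hg⟩ := LinearMap.exists_leftInverse_of_injective _ h1
    refine ⟨Matrix.of fun i => g (Pi.single i 1), ?_⟩
    have h3 : ∀ w, Matrix.vecMul w (Matrix.of fun i => g (Pi.single i (1 : ℚ))) = g w := by
      intro w
      conv_rhs => rw [← Finset.univ_sum_single w]
      rw [map_sum]
      ext j
      simp only [Matrix.vecMul, dotProduct, Matrix.of_apply, Finset.sum_apply]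
      refine Finset.sum_congr rfl fun i _ => ?_
      have : (Pi.single i (w i) : ι → ℚ) = w i • Pi.single i 1 := by
        rw [← Pi.single_smul]; simp
      rw [this, map_smul]; simp
    have h2 : ∀ v, Matrix.vecMul (Matrix.vecMul v A) (Matrix.of fun i => g (Pi.single i (1 : ℚ))) = v
        := fun v => by
      rw [h3]; exact congrArg (fun f => f v) hg
    apply Matrix.ext_of_single_vecMul
    intro j
    rw [← Matrix.vecMul_vecMul, h2, Matrix.vecMul_one]
  let f : (Fin d → ℝ) →ₗ[ℝ] (ι → ℝ) := Matrix.vecMulLinear (A.map (algebraMap ℚ ℝ))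
  have hfinv : ∀ v, Matrix.vecMul (f v) (B.map (algebraMap ℚ ℝ)) = v := fun v => by
    simp only [f, Matrix.vecMulLinear_apply]
    rw [Matrix.vecMul_vecMul, ← Matrix.map_mul, hB]
    simp
  have hfcont : Continuous f := LinearMap.continuous_of_finiteDimensional f
  let s : Set (Fin d → ℝ) := f ⁻¹' Metric.closedBall 0 1
  have hsb : Bornology.IsBounded s := by
    let g : (ι → ℝ) →ₗ[ℝ] (Fin d → ℝ) := Matrix.vecMulLinear (B.map (algebraMap ℚ ℝ))
    have hg : Continuous g := LinearMap.continuous_of_finiteDimensional g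
    refine ((isCompact_closedBall (0 : ι → ℝ) 1).image hg).isBounded.subset ?_
    intro v hv
    exact ⟨f v, hv, hfinv v⟩
  have hsc : IsClosed s := Metric.isClosed_closedBall.preimage hfcont
  have hsconv : Convex ℝ s := (convex_closedBall _ _).linear_preimage f
  have hlim := tendsto_card_div_pow_atTop_volume s hsb hsc.measurableSet
    (hsconv.addHaar_frontier volume)
  refine ⟨volume.real s, ?_, ?_⟩
  · refine ENNReal.toReal_pos (ne_of_gt ?_) hsb.measure_lt_top.ne
    apply Measure.measure_pos_of_mem_nhds volume (x := 0)
    apply hfcont.continuousAt.preimage_mem_nhds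
    rw [map_zero]
    exact Metric.closedBall_mem_nhds _ one_pos
  · refine hlim.congr' ?_
    filter_upwards [eventually_ge_atTop 1] with T hT
    have hT0 : (T : ℝ) ≠ 0 := by positivity
    have hTpos : (0 : ℝ) < T := by positivity
    have : NeZero T := ⟨by omega⟩
    rw [Fintype.card_fin]
    congr 2
    rw [Nat.card_coe_set_eq]
    let Z : Set (Fin d → ℤ) := {t | ∀ i, |∑ j, t j * b j i| ≤ T}
    have hfz : ∀ (t : Fin d → ℤ) (i : ι), f (fun j => (t j : ℝ)) i
        = ((∑ j, t j * b j i : ℤ) : ℝ) := by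
      intro t i
      simp [f, A, Matrix.vecMul, dotProduct, toRat]
    have h1 : intPoints V T = (fun t : Fin d → ℤ => ∑ j, t j • b j) '' Z := by
      ext z
      simp only [intPoints, Set.mem_ofPred_eq, Set.mem_image, Z]
      rw [hrep]
      constructor
      · rintro ⟨⟨t, rfl⟩, h⟩
        exact ⟨t, by simpa using h, rfl⟩
      · rintro ⟨t, h, rfl⟩
        exact ⟨⟨t, rfl⟩, by simpa using h⟩
    have h2 : s ∩ (T : ℝ)⁻¹ • (Submodule.span ℤ (Set.range (Pi.basisFun ℝ (Fin d))) : Set (Fin d → ℝ)) =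
        (fun t : Fin d → ℤ => fun j => (T : ℝ)⁻¹ * (t j : ℝ)) '' Z := by
      have hmem : ∀ t : Fin d → ℤ, (fun j => (T : ℝ)⁻¹ * (t j : ℝ)) ∈ s ↔ t ∈ Z := by
        intro t
        have : (fun j => (T : ℝ)⁻¹ * (t j : ℝ)) = (T : ℝ)⁻¹ • fun j => (t j : ℝ) := rfl
        simp only [s, Set.mem_preimage, mem_closedBall_zero_iff, Z, Set.mem_ofPred_eq]
        rw [this, map_smul, norm_smul, norm_inv, Real.norm_natCast, inv_mul_le_iff₀ hTpos,
          mul_one, pi_norm_le_iff_of_nonneg hTpos.le]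
        refine forall_congr' fun i => ?_
        rw [hfz, Real.norm_eq_abs]
        exact_mod_cast Iff.rfl
      ext v
      rw [Set.mem_inter_iff, ← Submodule.coe_pointwise_smul, SetLike.mem_coe,
        BoxIntegral.unitPartition.mem_smul_span_iff]
      constructor
      · rintro ⟨hv, hz⟩
        choose t ht using hz
        have : v = fun j => (T : ℝ)⁻¹ * (t j : ℝ) := by
          ext j
          have := ht j
          simp only [algebraMap_int_eq, eq_intCast] at this
          rw [this]; field_simp
        rw [this] at hv ⊢
        exact ⟨t, (hmem t).1 hv, rfl⟩
      · rintro ⟨t, ht, rfl⟩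
        refine ⟨(hmem t).2 ht, fun j => ⟨t j, ?_⟩⟩
        simp only [algebraMap_int_eq, eq_intCast]
        field_simp
    have hinj1 : Function.Injective (fun t : Fin d → ℤ => ∑ j, t j • b j) := by
      intro t t' htt
      have h0 := Fintype.linearIndependent_iff.1 hli (fun j => ((t j - t' j : ℤ) : ℚ)) (by
        ext i
        have := congrFun htt i
        simp only [Finset.sum_apply, Pi.smul_apply, smul_eq_mul] at this
        have h' : ((∑ j, t j * b j i : ℤ) : ℚ) = ((∑ j, t' j * b j i : ℤ) : ℚ) := by rw [this]
        push_cast at h'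
        simp [toRat, sub_mul, Finset.sum_sub_distrib, h'])
      ext j
      have := h0 j
      norm_cast at this
      omega
    have hinj2 : Function.Injective
        (fun t : Fin d → ℤ => fun j => (T : ℝ)⁻¹ * (t j : ℝ)) := by
      intro t t' htt
      ext j
      have := congrFun htt j
      simpa [hT0] using this
    rw [h1, h2, Set.ncard_image_of_injective _ hinj1, Set.ncard_image_of_injective _ hinj2]

/-- The density of the integer points of a rational subspace of dimension `d`: the limit of the
number of points of sup norm at most `T`, divided by `T ^ d`. -/
noncomputable def intDensity {ι : Type*} [Finite ι] (V : Submodule ℚ (ι → ℚ)) : ℝ :=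
  Classical.choose (exists_tendsto_intPoints V)

theorem intDensity_pos {ι : Type*} [Finite ι] (V : Submodule ℚ (ι → ℚ)) : 0 < intDensity V :=
  (Classical.choose_spec (exists_tendsto_intPoints V)).1

theorem tendsto_intDensity {ι : Type*} [Finite ι] (V : Submodule ℚ (ι → ℚ)) :
    Tendsto (fun T : ℕ => ((intPoints V T).ncard : ℝ) / (T : ℝ) ^ Module.finrank ℚ V) atTop
      (nhds (intDensity V)) :=
  (Classical.choose_spec (exists_tendsto_intPoints V)).2

/-- The logarithmic height of a rational subspace. The density of its integer points is, up to a
factor bounded in terms of the dimensions, the inverse of the covolume of its lattice of integer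
points, so this is the usual logarithmic height up to a bounded summand. -/
noncomputable def logHeight {ι : Type*} [Finite ι] (V : Submodule ℚ (ι → ℚ)) : ℝ :=
  -Real.log (intDensity V)

/-- The fibres of addition `A × B → A ⊔ B` are translates of parts of `A ⊓ B`. -/
theorem ncard_intPoints_mul_le {ι : Type*} [Finite ι] (A B : Submodule ℚ (ι → ℚ)) (T : ℕ) :
    (intPoints A T).ncard * (intPoints B T).ncard ≤
      (intPoints (A ⊔ B) (2 * T)).ncard * (intPoints (A ⊓ B) (2 * T)).ncard := by
  classical
  rw [← Set.ncard_prod, ← Set.ncard_prod]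
  let P : (ι → ℤ) → (ι → ℤ) → Prop := fun s a => a ∈ intPoints A T ∧ s - a ∈ intPoints B T
  let g : (ι → ℤ) → (ι → ℤ) := fun s => if h : ∃ a, P s a then h.choose else 0
  have hg : ∀ s, (∃ a, P s a) → P s (g s) := fun s h => by
    simp only [g, dif_pos h]; exact h.choose_spec
  have habs : ∀ a b : ℤ, |a| ≤ T → |b| ≤ T → |a + b| ≤ (2 * T : ℕ) ∧ |a - b| ≤ (2 * T : ℕ) := by
    intro a b ha hb
    rw [abs_le] at *
    push_cast
    rw [abs_le]
    omega
  refine Set.ncard_le_ncard_of_injOn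
    (fun p : (ι → ℤ) × (ι → ℤ) => (p.1 + p.2, p.1 - g (p.1 + p.2))) ?_ ?_
    ((finite_intPoints _ _).prod (finite_intPoints _ _))
  · rintro ⟨a, b⟩ ⟨ha, hb⟩
    simp only at ha hb
    have hP : P (a + b) (g (a + b)) := hg _ ⟨a, ha, by simpa using hb⟩
    refine ⟨⟨?_, fun i => (habs _ _ (ha.2 i) (hb.2 i)).1⟩, ⟨?_, ?_⟩,
      fun i => (habs _ _ (ha.2 i) (hP.1.2 i)).2⟩
    · simp only [toRat_add]
      exact Submodule.add_mem_sup ha.1 hb.1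
    · simp only [toRat_sub]
      exact A.sub_mem ha.1 hP.1.1
    · have : a - g (a + b) = (a + b - g (a + b)) - b := by abel
      simp only
      rw [this, toRat_sub]
      exact B.sub_mem hP.2.1 hb.1
  · rintro ⟨a, b⟩ - ⟨a', b'⟩ - h
    simp only [Prod.mk.injEq] at h
    obtain ⟨h1, h2⟩ := h
    rw [h1] at h2
    have h3 : a = a' := by simpa using h2
    subst h3
    have h4 : b = b' := by simpa using h1
    rw [h4]

theorem logHeight_inf_add_sup_le {ι : Type*} [Finite ι] (A B : Submodule ℚ (ι → ℚ)) :
    logHeight (A ⊓ B) + logHeight (A ⊔ B) ≤ logHeight A + logHeight B +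
      ((Module.finrank ℚ A + Module.finrank ℚ B : ℕ) : ℝ) * Real.log 2 := by
  have hdim := Submodule.finrank_sup_add_finrank_inf_eq A B
  set e := Module.finrank ℚ A + Module.finrank ℚ B with he
  have h2 : Tendsto (fun T : ℕ => 2 * T) atTop atTop :=
    tendsto_atTop_mono (fun T => by rw [id]; omega) tendsto_id
  have hl := (tendsto_intDensity A).mul (tendsto_intDensity B)
  have hr := (((tendsto_intDensity (A ⊔ B)).comp h2).mul
    ((tendsto_intDensity (A ⊓ B)).comp h2)).const_mul ((2 : ℝ) ^ e)
  have key : intDensity A * intDensity B ≤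
      2 ^ e * (intDensity (A ⊔ B) * intDensity (A ⊓ B)) := by
    refine le_of_tendsto_of_tendsto hl hr ?_
    filter_upwards [eventually_ge_atTop 1] with T hT
    have hT : (0 : ℝ) < T := by exact_mod_cast hT
    have hc : ((intPoints A T).ncard * (intPoints B T).ncard : ℝ) ≤
      (intPoints (A ⊔ B) (2 * T)).ncard * (intPoints (A ⊓ B) (2 * T)).ncard := by
      exact_mod_cast ncard_intPoints_mul_le A B T
    simp only [Function.comp]
    rw [div_mul_div_comm, div_mul_div_comm, ← pow_add, ← pow_add, hdim, ← he]
    push_cast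
    rw [mul_pow, ← mul_div_assoc, mul_div_mul_left _ _ (by positivity)]
    gcongr
  have hA := intDensity_pos A
  have hB := intDensity_pos B
  have hS := intDensity_pos (A ⊔ B)
  have hI := intDensity_pos (A ⊓ B)
  have hlog := Real.log_le_log (by positivity) key
  rw [Real.log_mul hA.ne' hB.ne', Real.log_mul (by positivity) (by positivity),
    Real.log_mul hS.ne' hI.ne', Real.log_pow] at hlog
  simp only [logHeight]
  linarith

/-- A line whose integer points are all far apart has a large height. -/
theorem le_logHeight_span_singleton {ι : Type*} [Finite ι] (x : ι → ℤ) (i₀ : ι) (hx : 0 < x i₀)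
    (hmin : ∀ (z : ι → ℤ) (r : ℚ), r ≠ 0 → toRat z = r • toRat x → 1 ≤ |r|) :
    Real.log (x i₀) - Real.log 2 ≤ logHeight (Submodule.span ℚ {toRat x}) := by
  have hx' : (0 : ℝ) < x i₀ := by exact_mod_cast hx
  have hxq : (0 : ℚ) < x i₀ := by exact_mod_cast hx
  have hx0 : toRat x ≠ 0 := fun h => by
    have := congrFun h i₀
    simp only [toRat, Pi.zero_apply] at this
    linarith
  have hdim : Module.finrank ℚ (Submodule.span ℚ {toRat x}) = 1 := finrank_span_singleton hx0
  have hlim := tendsto_intDensity (Submodule.span ℚ {toRat x})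
  rw [hdim] at hlim
  have hcount : ∀ T : ℕ, ((intPoints (Submodule.span ℚ {toRat x}) T).ncard : ℝ) ≤
      2 * T / x i₀ + 2 := by
    intro T
    set c : ℚ := (T : ℚ) / x i₀ with hc
    have h1 : (intPoints (Submodule.span ℚ {toRat x}) T).ncard ≤
        (Set.Icc ⌊-c⌋ ⌊c⌋ : Set ℤ).ncard := by
      refine Set.ncard_le_ncard_of_injOn (fun z : ι → ℤ => ⌊(z i₀ : ℚ) / x i₀⌋) ?_ ?_
        (Set.finite_Icc _ _)
      · rintro z ⟨-, hz⟩
        have hz' : |(z i₀ : ℚ)| ≤ T := by exact_mod_cast hz i₀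
        rw [abs_le] at hz'
        refine ⟨Int.floor_le_floor ?_, Int.floor_le_floor ?_⟩
        · rw [hc, ← neg_div]; gcongr; exact hz'.1
        · rw [hc]; gcongr; exact hz'.2
      · rintro z ⟨hz, -⟩ w ⟨hw, -⟩ hzw
        obtain ⟨r, hr⟩ := Submodule.mem_span_singleton.1 hz
        obtain ⟨s, hs⟩ := Submodule.mem_span_singleton.1 hw
        have hrz : (z i₀ : ℚ) / x i₀ = r := by
          have := congrFun hr i₀
          simp only [toRat, Pi.smul_apply, smul_eq_mul] at this
          rw [← this]; field_simp
        have hsw : (w i₀ : ℚ) / x i₀ = s := by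
          have := congrFun hs i₀
          simp only [toRat, Pi.smul_apply, smul_eq_mul] at this
          rw [← this]; field_simp
        simp only [hrz, hsw] at hzw
        have hlt := Int.abs_sub_lt_one_of_floor_eq_floor hzw
        by_contra hne
        have : r - s ≠ 0 := fun h => hne (toRat_injective (by
          rw [← hr, ← hs, sub_eq_zero.1 h]))
        have := hmin (z - w) (r - s) this (by rw [toRat_sub, ← hr, ← hs, sub_smul])
        linarith
    have h2 : ((Set.Icc ⌊-c⌋ ⌊c⌋ : Set ℤ).ncard : ℤ) = ⌊c⌋ + 1 - ⌊-c⌋ := by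
      rw [← Finset.coe_Icc, Set.ncard_coe_finset, Int.card_Icc, Int.toNat_of_nonneg]
      have : ⌊-c⌋ ≤ ⌊c⌋ := Int.floor_le_floor (by
        have : 0 ≤ c := by positivity
        linarith)
      omega
    have h3 : ((⌊c⌋ + 1 - ⌊-c⌋ : ℤ) : ℚ) ≤ 2 * c + 2 := by
      push_cast
      have := Int.floor_le c
      have := Int.lt_floor_add_one (-c)
      linarith
    have h4 : (((intPoints (Submodule.span ℚ {toRat x}) T).ncard : ℚ)) ≤ 2 * c + 2 := by
      refine le_trans ?_ h3
      rw [← h2]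
      exact_mod_cast h1
    have h5 : (((intPoints (Submodule.span ℚ {toRat x}) T).ncard : ℚ) : ℝ) ≤ ((2 * c + 2 : ℚ) : ℝ) :=
      by exact_mod_cast h4
    rw [hc] at h5
    push_cast at h5
    calc _ ≤ _ := h5
      _ = _ := by ring
  have hle : intDensity (Submodule.span ℚ {toRat x}) ≤ 2 / x i₀ := by
    have hr : Tendsto (fun T : ℕ => (2 : ℝ) / x i₀ + 2 * (T : ℝ)⁻¹) atTop
        (nhds (2 / x i₀ + 2 * 0)) :=
      (tendsto_inv_atTop_nhds_zero_nat.const_mul 2).const_add _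
    rw [mul_zero, add_zero] at hr
    refine le_of_tendsto_of_tendsto hlim hr ?_
    filter_upwards [eventually_ge_atTop 1] with T hT
    have hT : (0 : ℝ) < T := by exact_mod_cast hT
    rw [pow_one, div_le_iff₀ hT]
    calc _ ≤ _ := hcount T
      _ = _ := by field_simp
  have := Real.log_le_log (intDensity_pos _) hle
  rw [Real.log_div two_ne_zero hx'.ne'] at this
  simp only [logHeight]
  linarith

/-- Two integer points close to the line spanned by `ξ` span a plane of small height. -/
theorem logHeight_span_pair_le {ι : Type*} [Finite ι] (x y : ι → ℤ) (i₀ : ι) (ξ : ι → ℝ) (A δ : ℝ)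
    (hli : LinearIndependent ℚ ![toRat x, toRat y]) (hA : 1 ≤ A) (hξ : ∀ i, |ξ i| ≤ A)
    (hδ : 0 < δ) (hδ1 : δ ≤ 1) (hx0 : 1 ≤ x i₀) (hy0 : 1 ≤ y i₀) (hxy : x i₀ ≤ y i₀)
    (hx : ∀ i, |x i - ξ i * x i₀| ≤ δ) (hy : ∀ i, |y i - ξ i * y i₀| ≤ δ) :
    logHeight (Submodule.span ℚ {toRat x, toRat y}) ≤
      Real.log (y i₀ * δ) + Real.log (16 * A) := by
  have hX : (1 : ℝ) ≤ x i₀ := by exact_mod_cast hx0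
  have hY : (1 : ℝ) ≤ y i₀ := by exact_mod_cast hy0
  have hXY : (x i₀ : ℝ) ≤ y i₀ := by exact_mod_cast hxy
  set X : ℝ := (x i₀ : ℝ) with hXdef
  set Y : ℝ := (y i₀ : ℝ) with hYdef
  have hAp : 0 < A := by linarith
  have hXp : 0 < X := by linarith
  have hYp : 0 < Y := by linarith
  set V := Submodule.span ℚ {toRat x, toRat y} with hV
  have hdim : Module.finrank ℚ V = 2 := by
    have h := finrank_span_eq_card hli
    have hr : Set.range ![toRat x, toRat y] = {toRat x, toRat y} := by
      simp [Set.pair_comm]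
    rw [hr] at h
    simpa using h
  have hlim := tendsto_intDensity V
  rw [hdim] at hlim
  set c₁ : ℝ := 1 / (4 * A * X) with hc1
  set c₂ : ℝ := X / (4 * Y * δ) with hc2
  have hcount : ∀ T : ℕ, ⌊c₁ * T⌋₊ * ⌊c₂ * T⌋₊ ≤ (intPoints V T).ncard := by
    intro T
    have h0 : ((Finset.range ⌊c₁ * T⌋₊ ×ˢ Finset.range ⌊c₂ * T⌋₊ : Finset (ℕ × ℕ)) :
        Set (ℕ × ℕ)).ncard = ⌊c₁ * T⌋₊ * ⌊c₂ * T⌋₊ := by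
      rw [Set.ncard_coe_finset, Finset.card_product, Finset.card_range, Finset.card_range]
    rw [← h0]
    let a : ℕ × ℕ → ℤ := fun p => ⌈-((p.2 : ℝ) * Y / X)⌉ + p.1
    refine Set.ncard_le_ncard_of_injOn (fun p : ℕ × ℕ => a p • x + (p.2 : ℤ) • y) ?_ ?_
      (finite_intPoints _ _)
    · rintro ⟨k, b⟩ hp
      simp only [Finset.coe_product, Set.mem_prod, Finset.coe_range, Set.mem_Iio] at hp
      obtain ⟨hk, hb⟩ := hp
      refine ⟨?_, fun i => ?_⟩
      · rw [toRat_add, toRat_smul, toRat_smul]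
        refine V.add_mem (V.smul_mem _ (Submodule.subset_span (by simp)))
          (V.smul_mem _ (Submodule.subset_span (by simp)))
      · have hk' : (k : ℝ) + 1 ≤ c₁ * T := by
          have h1 : ((k + 1 : ℕ) : ℝ) ≤ (⌊c₁ * T⌋₊ : ℝ) := by exact_mod_cast hk
          have h2 := Nat.floor_le (show 0 ≤ c₁ * T by positivity)
          push_cast at h1
          linarith
        have hb' : (b : ℝ) ≤ c₂ * T := by
          have h1 : (b : ℝ) ≤ (⌊c₂ * T⌋₊ : ℝ) := by exact_mod_cast hb.le
          exact h1.trans (Nat.floor_le (by positivity))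
        -- `s` is the deviation of the first coefficient from the optimal real one
        set s : ℝ := (a (k, b) : ℝ) + b * Y / X with hs
        have hs0 : 0 ≤ s := by
          have := Int.le_ceil (-((b : ℝ) * Y / X))
          simp only [hs, a]
          push_cast
          have : (0 : ℝ) ≤ k := by positivity
          linarith
        have hs1 : s ≤ c₁ * T := by
          have := Int.ceil_lt_add_one (-((b : ℝ) * Y / X))
          simp only [hs, a]
          push_cast
          linarith
        have ha : (a (k, b) : ℝ) = s - b * Y / X := by rw [hs]; ring
        have hb0 : (0 : ℝ) ≤ b := by positivity
        have hdec : (((a (k, b) • x + (b : ℤ) • y) i : ℤ) : ℝ) =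
            s * (ξ i * X) + (s - b * Y / X) * (x i - ξ i * X) + b * (y i - ξ i * Y) := by
          simp only [Pi.add_apply, Pi.smul_apply, smul_eq_mul]
          push_cast
          rw [ha]
          field_simp
          ring
        have hYX : 1 ≤ Y / X := by rwa [le_div_iff₀ hXp, one_mul]
        have hbd : |(((a (k, b) • x + (b : ℤ) • y) i : ℤ) : ℝ)| ≤ T := by
          rw [hdec]
          have e1 : |s * (ξ i * X)| ≤ s * (A * X) := by
            rw [abs_mul, abs_mul, abs_of_nonneg hs0, abs_of_pos hXp]
            have := hξ i
            gcongr
          have e2 : |(s - b * Y / X) * (x i - ξ i * X)| ≤ (s + b * (Y / X)) * δ := by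
            rw [abs_mul]
            have : |s - b * Y / X| ≤ s + b * (Y / X) := by
              have h := abs_sub s (b * Y / X)
              have h' : 0 ≤ b * (Y / X) := by positivity
              rw [abs_le, mul_div_assoc]
              constructor <;> linarith
            have := hx i
            gcongr
          have e3 : |b * (y i - ξ i * Y)| ≤ (b * (Y / X)) * δ := by
            rw [abs_mul, abs_of_nonneg hb0]
            have := hy i
            gcongr
            nlinarith
          have e4 : s * (A * X) + (s + b * (Y / X)) * δ + (b * (Y / X)) * δ ≤ T := by
            have f1 : s * (A * X) + s * δ ≤ (c₁ * T) * (2 * A * X) := by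
              calc s * (A * X) + s * δ ≤ s * (A * X) + s * (A * X) := by
                    gcongr
                    nlinarith
                _ = s * (2 * A * X) := by ring
                _ ≤ _ := by gcongr
            have f2 : 2 * (b * (Y / X)) * δ ≤ 2 * ((c₂ * T) * (Y / X)) * δ := by gcongr
            have g1 : (c₁ * T) * (2 * A * X) = T / 2 := by
              rw [hc1]; field_simp; ring
            have g2 : 2 * ((c₂ * T) * (Y / X)) * δ = T / 2 := by
              rw [hc2]; field_simp; norm_num
            linarith
          refine (abs_add_three _ _ _).trans ?_
          linarith
        exact_mod_cast hbd
    · rintro ⟨k, b⟩ - ⟨k', b'⟩ - h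
      simp only at h
      have h1 : (((a (k, b) : ℤ) : ℚ) - a (k', b')) • toRat x +
          (((b : ℤ) : ℚ) - (b' : ℤ)) • toRat y = 0 := by
        have h2 := congrArg toRat h
        rw [toRat_add, toRat_smul, toRat_smul, toRat_add, toRat_smul, toRat_smul] at h2
        rw [sub_smul, sub_smul]
        have : ∀ p q r s : ι → ℚ, p + q = r + s → p - r + (q - s) = 0 := by
          intro p q r s h
          rw [sub_add_sub_comm, h, sub_self]
        exact this _ _ _ _ h2
      obtain ⟨h3, h4⟩ := LinearIndependent.pair_iff.1 hli _ _ h1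
      have hb : b = b' := by
        have : ((b : ℤ) : ℚ) = (b' : ℤ) := by linarith
        exact_mod_cast this
      subst hb
      have hk : k = k' := by
        have : ((a (k, b) : ℤ) : ℚ) = a (k', b) := by linarith
        have : a (k, b) = a (k', b) := by exact_mod_cast this
        simp only [a] at this
        omega
      rw [hk]
  have hle : c₁ * c₂ ≤ intDensity V := by
    have t1 := (tendsto_nat_floor_mul_div_atTop (show 0 ≤ c₁ by positivity)).comp
      (tendsto_natCast_atTop_atTop (R := ℝ))
    have t2 := (tendsto_nat_floor_mul_div_atTop (show 0 ≤ c₂ by positivity)).comp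
      (tendsto_natCast_atTop_atTop (R := ℝ))
    refine le_of_tendsto_of_tendsto (t1.mul t2) hlim ?_
    filter_upwards with T
    simp only [Function.comp]
    rw [div_mul_div_comm, ← sq]
    gcongr
    exact_mod_cast hcount T
  have hcc : c₁ * c₂ = (Y * δ * (16 * A))⁻¹ := by
    rw [hc1, hc2]; field_simp; norm_num
  rw [hcc] at hle
  have := Real.log_le_log (by positivity) hle
  rw [Real.log_inv, Real.log_mul (by positivity) (by positivity)] at this
  simp only [logHeight]
  linarith

theorem finrank_span_pair {K E : Type*} [Field K] [AddCommGroup E] [Module K E] {v w : E}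
    (h : LinearIndependent K ![v, w]) : Module.finrank K (Submodule.span K {v, w}) = 2 := by
  have h' := finrank_span_eq_card h
  have hr : Set.range ![v, w] = {v, w} := by simp [Set.pair_comm]
  rw [hr] at h'
  simpa using h'

/-- For a sequence of integer points all of whose tails span the whole space, consider the planes
spanned by consecutive points. For some two successive planes, the heights of these planes control
the height of their common line. This combines the submodularity of the height with the concavity
lemma; the constant depends on the dimension only. -/
theorem exists_logHeight_add_le (e : ℕ) : ∃ C : ℝ, ∀ x : ℕ → Fin (e + 3) → ℤ,
    (∀ k, LinearIndependent ℚ ![toRat (x k), toRat (x (k + 1))]) →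
    (∀ j, Submodule.span ℚ (Set.range fun k => toRat (x (k + j))) = ⊤) →
    ∃ k, logHeight (Submodule.span ℚ {toRat (x (k + 1))}) + (e : ℝ) / (e + 1) *
        min (logHeight (Submodule.span ℚ {toRat (x k), toRat (x (k + 1))}))
          (logHeight (Submodule.span ℚ {toRat (x (k + 1)), toRat (x (k + 2))})) ≤
      logHeight (Submodule.span ℚ {toRat (x k), toRat (x (k + 1))}) +
        logHeight (Submodule.span ℚ {toRat (x (k + 1)), toRat (x (k + 2))}) + C := by
  set c : ℝ := ((e + 3 : ℕ) : ℝ) * Real.log 2 with hc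
  have hlog2 : 0 < Real.log 2 := Real.log_pos one_lt_two
  have hc0 : 0 ≤ c := by positivity
  set D : ℝ := c * ((e + 3 : ℕ) : ℝ) ^ 2 +
    |logHeight (⊤ : Submodule ℚ (Fin (e + 3) → ℚ))| with hD
  -- a summand that is concave in the dimension turns submodularity up to a constant into
  -- submodularity
  let h : Submodule ℚ (Fin (e + 3) → ℚ) → ℝ := fun V =>
    logHeight V - c * (Module.finrank ℚ V : ℝ) ^ 2 + D
  have hrank : Module.finrank ℚ (Fin (e + 3) → ℚ) = e + 3 := by simp
  have hle : ∀ V : Submodule ℚ (Fin (e + 3) → ℚ), (Module.finrank ℚ V : ℝ) ≤ (e + 3 : ℕ) :=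
    fun V => by
      have := Submodule.finrank_le V
      rw [hrank] at this
      exact_mod_cast this
  have hlow : ∀ V, logHeight V ≤ h V := fun V => by
    have : c * (Module.finrank ℚ V : ℝ) ^ 2 ≤ c * ((e + 3 : ℕ) : ℝ) ^ 2 := by
      have := hle V
      gcongr
    have := abs_nonneg (logHeight (⊤ : Submodule ℚ (Fin (e + 3) → ℚ)))
    simp only [h]
    linarith
  have hupp : ∀ V, h V ≤ logHeight V + D := fun V => by
    have : 0 ≤ c * (Module.finrank ℚ V : ℝ) ^ 2 := by positivity
    simp only [h]
    linarith
  have htop : 0 ≤ h ⊤ := by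
    have := neg_abs_le (logHeight (⊤ : Submodule ℚ (Fin (e + 3) → ℚ)))
    simp only [h, hD]
    rw [finrank_top, hrank]
    linarith
  have hsub : ∀ A B : Submodule ℚ (Fin (e + 3) → ℚ), Module.finrank ℚ A = Module.finrank ℚ B →
      Module.finrank ℚ A = Module.finrank ℚ (A ⊓ B : Submodule ℚ (Fin (e + 3) → ℚ)) + 1 →
      h (A ⊓ B) + h (A ⊔ B) ≤ h A + h B := by
    intro A B hAB hI
    have h1 := Submodule.finrank_sup_add_finrank_inf_eq A B
    have h2 := logHeight_inf_add_sup_le A B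
    have hA := hle A
    simp only [h]
    generalize Module.finrank ℚ (A ⊓ B : Submodule ℚ (Fin (e + 3) → ℚ)) = i at *
    have hB : Module.finrank ℚ B = i + 1 := by omega
    have hS : Module.finrank ℚ (A ⊔ B : Submodule ℚ (Fin (e + 3) → ℚ)) = i + 2 := by omega
    rw [hS]
    rw [hI] at h2 hA ⊢
    rw [hB] at h2 ⊢
    have h3 : ((i + 1 + (i + 1) : ℕ) : ℝ) * Real.log 2 ≤ 2 * c := by
      rw [hc, ← mul_assoc]
      gcongr
      push_cast at hA ⊢
      linarith
    push_cast at *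
    nlinarith
  refine ⟨D + ((2 + 2 : ℕ) : ℝ) * Real.log 2, fun x hli hspan => ?_⟩
  set U : ℕ → Submodule ℚ (Fin (e + 3) → ℚ) :=
    fun k => Submodule.span ℚ {toRat (x k), toRat (x (k + 1))} with hU
  have hdim : ∀ k, Module.finrank ℚ (U k) = 2 := fun k => finrank_span_pair (hli k)
  have hline : ∀ k, Module.finrank ℚ (Submodule.span ℚ {toRat (x (k + 1))}) = 1 := fun k =>
    finrank_span_singleton (by simpa using (hli k).ne_zero 1)
  have hinf : ∀ k, Submodule.span ℚ {toRat (x (k + 1))} ≤ U k ⊓ U (k + 1) := fun k =>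
    le_inf (Submodule.span_mono (by simp)) (Submodule.span_mono (by simp))
  have hsum : ∀ k, Module.finrank ℚ (U k ⊔ U (k + 1) : Submodule ℚ (Fin (e + 3) → ℚ)) +
      Module.finrank ℚ (U k ⊓ U (k + 1) : Submodule ℚ (Fin (e + 3) → ℚ)) = 4 := fun k => by
    rw [Submodule.finrank_sup_add_finrank_inf_eq, hdim, hdim]
  have hone : ∀ k, 1 ≤ Module.finrank ℚ (U k ⊓ U (k + 1) : Submodule ℚ (Fin (e + 3) → ℚ)) :=
    fun k => (hline k).symm.le.trans (Submodule.finrank_mono (hinf k))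
  obtain ⟨k, hne, hk⟩ := exists_le_sup_of_submodular h htop hsub e 2 U (by rw [hrank]; omega) hdim
    (fun k => by have := hsum k; have := hone k; omega)
    (fun j => by
      rw [eq_top_iff, ← hspan j, Submodule.span_le]
      rintro _ ⟨k, rfl⟩
      exact Submodule.mem_iSup_of_mem k (Submodule.subset_span (by simp)))
  refine ⟨k, ?_⟩
  have heq : Submodule.span ℚ {toRat (x (k + 1))} = U k ⊓ U (k + 1) := by
    refine Submodule.eq_of_le_of_finrank_le (hinf k) ?_
    rw [hline]
    have : Module.finrank ℚ (U k ⊓ U (k + 1) : Submodule ℚ (Fin (e + 3) → ℚ)) <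
        Module.finrank ℚ (U k) := by
      apply Submodule.finrank_lt_finrank_of_lt
      refine lt_of_le_of_ne inf_le_left fun h => hne ?_
      exact Submodule.eq_of_le_of_finrank_eq (inf_eq_left.1 h) (by rw [hdim, hdim])
    rw [hdim] at this
    omega
  have h2 := logHeight_inf_add_sup_le (U k) (U (k + 1))
  rw [hdim, hdim, ← heq] at h2
  have h3 := hupp (U k ⊔ U (k + 1))
  have h4 : (e : ℝ) / (e + 1) * min (logHeight (U k)) (logHeight (U (k + 1))) ≤
      (e : ℝ) / (e + 1) * min (h (U k)) (h (U (k + 1))) :=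
    mul_le_mul_of_nonneg_left (min_le_min (hlow _) (hlow _)) (by positivity)
  change _ + (e : ℝ) / (e + 1) * min (logHeight (U k)) (logHeight (U (k + 1))) ≤
    logHeight (U k) + logHeight (U (k + 1)) + _
  have h5 := add_le_add_right (h4.trans (hk.trans h3)) (logHeight (Submodule.span ℚ {toRat (x (k + 1))}))
  refine h5.trans ?_
  linarith

/-! ### Best approximations to the powers of a number -/

/-- The integers nearest to `ζ ^ i * q`, for all `i`; the entry at `0` is `q` itself. -/
noncomputable def approxVec (ζ : ℝ) (q : ℕ) (i : ℕ) : ℤ := round (ζ ^ i * q)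

/-- The quality of the approximation to `ζ, …, ζ ^ m` with denominator `q`. -/
noncomputable def approxErr (m : ℕ) (ζ : ℝ) (q : ℕ) : ℝ :=
  ‖fun i : Fin (m + 1) => ζ ^ (i : ℕ) * q - approxVec ζ q i‖

@[simp] theorem approxVec_zero (ζ : ℝ) (q : ℕ) : approxVec ζ q 0 = q := by
  simp [approxVec]

theorem approxErr_nonneg (m : ℕ) (ζ : ℝ) (q : ℕ) : 0 ≤ approxErr m ζ q := norm_nonneg _

theorem abs_sub_approxVec_le {m i : ℕ} (hi : i ≤ m) (ζ : ℝ) (q : ℕ) :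
    |ζ ^ i * q - approxVec ζ q i| ≤ approxErr m ζ q :=
  norm_le_pi_norm (fun i : Fin (m + 1) => ζ ^ (i : ℕ) * q - approxVec ζ q i) ⟨i, by omega⟩

theorem approxErr_le {m : ℕ} {ζ : ℝ} {q : ℕ} {δ : ℝ} (hδ : 0 ≤ δ) (z : ℕ → ℤ)
    (h : ∀ i ≤ m, |ζ ^ i * q - z i| ≤ δ) : approxErr m ζ q ≤ δ := by
  refine (pi_norm_le_iff_of_nonneg hδ).2 fun i => ?_
  exact (round_le _ (z i)).trans (h i (by omega))

theorem approxErr_le_one (m : ℕ) (ζ : ℝ) (q : ℕ) : approxErr m ζ q ≤ 1 := by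
  refine (pi_norm_le_iff_of_nonneg zero_le_one).2 fun i => ?_
  exact (abs_sub_round _).trans (by norm_num)

theorem approxErr_pos {m : ℕ} (hm : 1 ≤ m) {ζ : ℝ} (hζ : Irrational ζ) {q : ℕ} (hq : 1 ≤ q) :
    0 < approxErr m ζ q := by
  refine lt_of_lt_of_le ?_ (abs_sub_approxVec_le hm ζ q)
  rw [abs_pos, pow_one]
  intro h
  exact (hζ.mul_natCast (m := q) (by omega)).ne_int (approxVec ζ q 1) (by linarith)

theorem SimApproxSolvable.exists_approxErr_le {m : ℕ} {ζ l X : ℝ}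
    (h : SimApproxSolvable m ζ l X) :
    ∃ q : ℕ, 1 ≤ q ∧ (q : ℝ) ≤ X ∧ approxErr m ζ q ≤ X ^ (-l) := by
  obtain ⟨x, y, h1, h2, h3⟩ := h
  have hX : 0 ≤ X := by linarith
  have hxq : ((x.natAbs : ℕ) : ℝ) = |(x : ℝ)| := by
    rw [Nat.cast_natAbs]; push_cast; rfl
  refine ⟨x.natAbs, ?_, by rw [hxq]; exact h2, ?_⟩
  · have : (1 : ℝ) ≤ (x.natAbs : ℝ) := by rw [hxq]; exact h1
    exact_mod_cast this
  · let y' : ℕ → ℤ := fun i => if h : 1 ≤ i ∧ i - 1 < m then y ⟨i - 1, h.2⟩ else x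
    have hy' : ∀ i ≤ m, |ζ ^ i * (x : ℝ) - y' i| ≤ X ^ (-l) := by
      intro i hi
      rcases Nat.eq_zero_or_pos i with rfl | hi0
      · simpa [y'] using Real.rpow_nonneg hX _
      · have := h3 ⟨i - 1, by omega⟩
        simp only [y', dif_pos (show 1 ≤ i ∧ i - 1 < m by omega)]
        simpa [Nat.sub_add_cancel hi0] using this
    refine approxErr_le (Real.rpow_nonneg hX _) (fun i => x.sign * y' i) fun i hi => ?_
    have hs : ((x.natAbs : ℕ) : ℝ) = (x.sign : ℝ) * x := by
      have := Int.sign_mul_self_eq_natAbs x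
      rw [← Int.cast_natCast, ← this]; push_cast; rfl
    have hx0 : x ≠ 0 := by rintro rfl; simp at h1; linarith
    have hsa : |(x.sign : ℝ)| = 1 := by
      rcases lt_or_gt_of_ne hx0 with h | h
      · rw [Int.sign_eq_neg_one_of_neg h]; simp
      · rw [Int.sign_eq_one_of_pos h]; simp
    rw [hs]
    push_cast
    rw [show ζ ^ i * ((x.sign : ℝ) * x) - x.sign * y' i = x.sign * (ζ ^ i * x - y' i) by ring,
      abs_mul, hsa, one_mul]
    exact hy' i hi

/-- `q` lists the positive integers at which `L` takes a value smaller than all values before. -/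
structure IsRecordSeq (L : ℕ → ℝ) (q : ℕ → ℕ) : Prop where
  strictMono : StrictMono q
  zero : q 0 = 1
  le_of_lt : ∀ k p, 1 ≤ p → p < q (k + 1) → L (q k) ≤ L p
  anti : ∀ k, L (q (k + 1)) < L (q k)

theorem IsRecordSeq.one_le {L : ℕ → ℝ} {q : ℕ → ℕ} (h : IsRecordSeq L q) (k : ℕ) : 1 ≤ q k := by
  have := h.strictMono.monotone (Nat.zero_le k)
  rwa [h.zero] at this

theorem IsRecordSeq.lt_of_lt {L : ℕ → ℝ} {q : ℕ → ℕ} (h : IsRecordSeq L q) (k p : ℕ)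
    (hp : 1 ≤ p) (hpk : p < q k) : L (q k) < L p := by
  cases k with
  | zero => rw [h.zero] at hpk; omega
  | succ k => exact (h.anti k).trans_le (h.le_of_lt k p hp hpk)

theorem exists_isRecordSeq (L : ℕ → ℝ) (hpos : ∀ p, 1 ≤ p → 0 < L p)
    (hsmall : ∀ ε > 0, ∃ p, 1 ≤ p ∧ L p < ε) : ∃ q, IsRecordSeq L q := by
  classical
  have hex : ∀ p : {p : ℕ // 1 ≤ p}, ∃ r, 1 ≤ r ∧ L r < L p := fun p => hsmall _ (hpos p p.2)
  let S : {p : ℕ // 1 ≤ p} → {p : ℕ // 1 ≤ p} := fun p =>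
    ⟨Nat.find (hex p), (Nat.find_spec (hex p)).1⟩
  let Q : ℕ → {p : ℕ // 1 ≤ p} := fun k => S^[k] ⟨1, le_rfl⟩
  have hQ : ∀ k, Q (k + 1) = S (Q k) := fun k => Function.iterate_succ_apply' S k _
  have hle : ∀ (k p : ℕ), 1 ≤ p → p < Q (k + 1) → L (Q k) ≤ L p := by
    intro k p hp hpk
    rw [hQ] at hpk
    have := Nat.find_min (hex (Q k)) hpk
    by_contra! hcon
    exact this ⟨hp, hcon⟩
  have hanti : ∀ k, L (Q (k + 1)) < L (Q k) := fun k => by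
    rw [hQ]; exact (Nat.find_spec (hex (Q k))).2
  refine ⟨fun k => Q k, strictMono_nat_of_lt_succ fun k => ?_, rfl, hle, hanti⟩
  have hlt : ∀ p : ℕ, 1 ≤ p → p < Q k → L (Q k) < L p := by
    cases k with
    | zero => intro p hp hp'; have h0 : (Q 0 : ℕ) = 1 := rfl; omega
    | succ k => exact fun p hp hpk => (hanti k).trans_le (hle k p hp hpk)
  by_contra! hcon
  rcases hcon.lt_or_eq with h | h
  · exact absurd (hlt _ (Q (k + 1)).2 h) (hanti k).le.not_gt
  · have := hanti k
    rw [h] at this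
    exact lt_irrefl _ this

/-- Uniform solvability with exponent `l` bounds the error of each best approximation in terms of
the next denominator. -/
theorem IsRecordSeq.eventually_le_rpow {m : ℕ} {ζ l μ : ℝ} {q : ℕ → ℕ}
    (hq : IsRecordSeq (approxErr m ζ) q) (hμl : μ < l)
    (h : ∀ᶠ X : ℝ in atTop, SimApproxSolvable m ζ l X) :
    ∀ᶠ k in atTop, approxErr m ζ (q k) ≤ (q (k + 1) : ℝ) ^ (-μ) := by
  have hqt : Tendsto (fun k => (q (k + 1) : ℝ)) atTop atTop :=
    tendsto_natCast_atTop_atTop.comp ((tendsto_add_atTop_iff_nat 1).2 hq.strictMono.tendsto_atTop)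
  have h1 : ∀ᶠ k in atTop, SimApproxSolvable m ζ l ((q (k + 1) : ℝ) / 2) :=
    (hqt.atTop_div_const two_pos).eventually h
  have h2 : ∀ᶠ k in atTop, (2 : ℝ) ^ l ≤ (q (k + 1) : ℝ) ^ (l - μ) :=
    ((tendsto_rpow_atTop (sub_pos.2 hμl)).comp hqt).eventually_ge_atTop _
  filter_upwards [h1, h2] with k hk1 hk2
  obtain ⟨p, hp1, hp2, hp3⟩ := hk1.exists_approxErr_le
  have hq1 := hq.one_le (k + 1)
  have hqpos : (0 : ℝ) < q (k + 1) := by exact_mod_cast hq1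
  have hlt : p < q (k + 1) := by
    have : (p : ℝ) < q (k + 1) := by linarith
    exact_mod_cast this
  refine (hq.le_of_lt k p hp1 hlt).trans (hp3.trans ?_)
  rw [Real.div_rpow hqpos.le two_pos.le, Real.rpow_neg two_pos.le, div_inv_eq_mul]
  calc (q (k + 1) : ℝ) ^ (-l) * 2 ^ l ≤ (q (k + 1) : ℝ) ^ (-l) * (q (k + 1) : ℝ) ^ (l - μ) := by
        gcongr
    _ = _ := by rw [← Real.rpow_add hqpos]; congr 1; ring

/-- The integer point with denominator `q` that approximates `(1, ζ, …, ζ ^ m)`. -/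
noncomputable def approxPoint (m : ℕ) (ζ : ℝ) (q : ℕ) : Fin (m + 1) → ℤ :=
  fun i => approxVec ζ q i

/-- A nonzero integer point on the line of a best approximation is at least as far out. -/
theorem IsRecordSeq.one_le_abs_of_eq_smul {m : ℕ} {ζ : ℝ} {q : ℕ → ℕ}
    (hq : IsRecordSeq (approxErr m ζ) q) (hpos : ∀ k, 0 < approxErr m ζ (q k)) (k : ℕ)
    (z : Fin (m + 1) → ℤ) (r : ℚ) (hr : r ≠ 0)
    (hz : toRat z = r • toRat (approxPoint m ζ (q k))) : 1 ≤ |r| := by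
  by_contra! hlt
  have hzi : ∀ i, (z i : ℝ) = r * approxVec ζ (q k) i := fun i => by
    have := congrFun hz i
    simp only [toRat, Pi.smul_apply, smul_eq_mul, approxPoint] at this
    exact_mod_cast congrArg (Rat.cast (K := ℝ)) this
  have hz0 : (z 0 : ℝ) = r * q k := by
    have := hzi 0
    simpa using this
  have hqk : (1 : ℝ) ≤ q k := by exact_mod_cast hq.one_le k
  have hrR : (r : ℝ) ≠ 0 := by exact_mod_cast hr
  have hltR : |(r : ℝ)| < 1 := by exact_mod_cast hlt
  have hz0ne : z 0 ≠ 0 := by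
    intro h
    rw [h] at hz0
    simp only [Int.cast_zero, zero_eq_mul] at hz0
    rcases hz0 with h | h
    · exact hrR h
    · linarith
  -- the point, with the sign chosen so that its denominator is positive
  set s : ℝ := ((z 0).sign : ℝ) * r with hs
  have hnat : (((z 0).natAbs : ℕ) : ℝ) = s * q k := by
    have := Int.sign_mul_self_eq_natAbs (z 0)
    rw [← Int.cast_natCast, ← this]; push_cast; rw [hz0, hs]; ring
  have hsa : |s| = |(r : ℝ)| := by
    rw [hs, abs_mul]
    rcases lt_or_gt_of_ne hz0ne with h | h
    · rw [Int.sign_eq_neg_one_of_neg h]; simp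
    · rw [Int.sign_eq_one_of_pos h]; simp
  have hp1 : 1 ≤ (z 0).natAbs := by omega
  have hplt : (z 0).natAbs < q k := by
    have : (((z 0).natAbs : ℕ) : ℝ) < q k := by
      rw [hnat]
      have := le_abs_self s
      nlinarith
    exact_mod_cast this
  have h1 := hq.lt_of_lt k _ hp1 hplt
  have h2 : approxErr m ζ (z 0).natAbs ≤ |(r : ℝ)| * approxErr m ζ (q k) := by
    let z' : ℕ → ℤ := fun i => if h : i < m + 1 then (z 0).sign * z ⟨i, h⟩ else 0
    refine approxErr_le (mul_nonneg (abs_nonneg _) (approxErr_nonneg _ _ _)) z' fun i hi => ?_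
    have hz' : (z' i : ℝ) = s * approxVec ζ (q k) i := by
      simp only [z', dif_pos (show i < m + 1 by omega)]
      push_cast
      rw [hzi, hs]; ring
    rw [hnat, hz', show ζ ^ i * (s * q k) - s * approxVec ζ (q k) i =
      s * (ζ ^ i * q k - approxVec ζ (q k) i) by ring, abs_mul, hsa]
    exact mul_le_mul_of_nonneg_left (abs_sub_approxVec_le hi ζ (q k)) (abs_nonneg _)
  have := hpos k
  nlinarith

theorem toRat_approxPoint_ne_zero (m : ℕ) (ζ : ℝ) {q : ℕ} (hq : 1 ≤ q) :
    toRat (approxPoint m ζ q) ≠ 0 := fun h => by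
  have := congrFun h 0
  simp [toRat, approxPoint] at this
  omega

theorem IsRecordSeq.linearIndependent {m : ℕ} {ζ : ℝ} {q : ℕ → ℕ}
    (hq : IsRecordSeq (approxErr m ζ) q) (hpos : ∀ k, 0 < approxErr m ζ (q k)) (k : ℕ) :
    LinearIndependent ℚ
      ![toRat (approxPoint m ζ (q k)), toRat (approxPoint m ζ (q (k + 1)))] := by
  rw [LinearIndependent.pair_iff' (toRat_approxPoint_ne_zero m ζ (hq.one_le k))]
  intro r hr
  have hr0 : r ≠ 0 := by
    rintro rfl
    rw [zero_smul] at hr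
    exact toRat_approxPoint_ne_zero m ζ (hq.one_le (k + 1)) hr.symm
  have h1 := hq.one_le_abs_of_eq_smul hpos (k + 1) (approxPoint m ζ (q k)) r⁻¹
    (inv_ne_zero hr0) (by rw [← hr, smul_smul, inv_mul_cancel₀ hr0, one_smul])
  have h2 : ((q (k + 1) : ℕ) : ℚ) = r * (q k : ℕ) := by
    have := congrFun hr 0
    simp [toRat, approxPoint] at this
    exact this.symm
  have h3 : ((q k : ℕ) : ℚ) < (q (k + 1) : ℕ) := by
    exact_mod_cast hq.strictMono (Nat.lt_succ_self k)
  have h4 : (0 : ℚ) < (q k : ℕ) := by exact_mod_cast hq.one_le k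
  rw [abs_inv] at h1
  have h5 : |r| ≤ 1 := by
    have := (one_le_inv₀ (abs_pos.2 hr0)).1 h1
    exact this
  have := le_abs_self r
  nlinarith

theorem IsRecordSeq.span_eq_top {m : ℕ} {ζ : ℝ} (hζ : Transcendental ℚ ζ) {q : ℕ → ℕ}
    (hq : IsRecordSeq (approxErr m ζ) q) (j : ℕ) :
    Submodule.span ℚ (Set.range fun k => toRat (approxPoint m ζ (q (k + j)))) = ⊤ := by
  by_contra hne
  obtain ⟨f, hf0, hf⟩ := Submodule.exists_le_ker_of_lt_top _ (lt_top_iff_ne_top.2 hne)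
  set c : Fin (m + 1) → ℚ := fun i => f (Pi.single i 1) with hc
  have hfc : ∀ v, f v = ∑ i, c i * v i := fun v => by
    conv_lhs => rw [← Finset.univ_sum_single v]
    rw [map_sum]
    refine Finset.sum_congr rfl fun i _ => ?_
    have : (Pi.single i (v i) : Fin (m + 1) → ℚ) = v i • Pi.single i 1 := by
      rw [← Pi.single_smul]; simp
    rw [this, map_smul, smul_eq_mul, hc, mul_comm]
  have hker : ∀ k, ∑ i, (c i : ℝ) * approxVec ζ (q (k + j)) i = 0 := fun k => by
    have h1 : f (toRat (approxPoint m ζ (q (k + j)))) = 0 := hf (Submodule.subset_span ⟨k, rfl⟩)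
    rw [hfc] at h1
    have := congrArg (Rat.cast (K := ℝ)) h1
    simpa [toRat, approxPoint] using this
  set v : ℝ := ∑ i, (c i : ℝ) * ζ ^ (i : ℕ) with hv
  have hbound : ∀ k, |v| * q (k + j) ≤ ∑ i, |(c i : ℝ)| := fun k => by
    have h1 : v * q (k + j) =
        ∑ i : Fin (m + 1), (c i : ℝ) * (ζ ^ (i : ℕ) * q (k + j) - approxVec ζ (q (k + j)) i) := by
      simp only [mul_sub, Finset.sum_sub_distrib]
      rw [hker k, sub_zero, hv, Finset.sum_mul]
      exact Finset.sum_congr rfl fun i _ => by ring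
    have h2 : |v| * q (k + j) = |v * q (k + j)| := by rw [abs_mul, Nat.abs_cast]
    rw [h2, h1]
    refine (Finset.abs_sum_le_sum_abs _ _).trans (Finset.sum_le_sum fun i _ => ?_)
    rw [abs_mul]
    have h3 := (abs_sub_approxVec_le (Nat.lt_succ_iff.1 i.2) ζ (q (k + j))).trans
      (approxErr_le_one m ζ _)
    exact mul_le_of_le_one_right (abs_nonneg _) h3
  have hv0 : v = 0 := by
    by_contra hv0
    have hpos : 0 < |v| := abs_pos.2 hv0
    have ht : Tendsto (fun k => |v| * (q (k + j) : ℝ)) atTop atTop :=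
      (tendsto_natCast_atTop_atTop.comp
        ((tendsto_add_atTop_iff_nat j).2 hq.strictMono.tendsto_atTop)).const_mul_atTop hpos
    obtain ⟨k, hk⟩ := (ht.eventually_gt_atTop (∑ i, |(c i : ℝ)|)).exists
    exact absurd (hbound k) (not_le.2 hk)
  -- the coefficients of the linear form make up a polynomial that vanishes at `ζ`
  have hp := (transcendental_iff.1 hζ) (∑ i : Fin (m + 1), Polynomial.monomial (i : ℕ) (c i)) (by
    rw [map_sum]
    simp only [Polynomial.aeval_monomial]
    exact hv0)
  have hc0 : ∀ i, c i = 0 := fun i => by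
    have := congrArg (fun p => Polynomial.coeff p (i : ℕ)) hp
    simpa [Polynomial.finsetSum_coeff, Polynomial.coeff_monomial, Fin.val_inj] using this
  exact hf0 (LinearMap.ext fun v => by rw [hfc]; simp [hc0])

/-! ### Polynomials that annihilate a sequence -/

/-- The linear form on polynomials that sends `X ^ i` to `y i`. -/
noncomputable def seqForm (y : ℕ → ℤ) : Polynomial ℚ →ₗ[ℚ] ℚ :=
  Polynomial.lsum fun i => (y i : ℚ) • LinearMap.id

/-- `P`, read as a binary form of degree `D`, annihilates `y 0, …, y m`: these numbers satisfy the
linear recurrence whose characteristic polynomial is `P`. For `P.natDegree < D` the form has a root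
at infinity, and the recurrence is required for fewer shifts than `P` alone would allow. -/
def Annihilates (y : ℕ → ℤ) (m D : ℕ) (P : Polynomial ℚ) : Prop :=
  P.natDegree ≤ D ∧ ∀ S : Polynomial ℚ, S.natDegree + D ≤ m → seqForm y (P * S) = 0

/-- The value of the linear form of `y` at `X ^ j * P`, as an integer. -/
def shiftSum (y : ℕ → ℤ) (D : ℕ) (P : Polynomial ℤ) (j : ℕ) : ℤ :=
  ∑ i ∈ Finset.range (D + 1), P.coeff i * y (i + j)

theorem seqForm_X_pow (y : ℕ → ℤ) (i : ℕ) : seqForm y (Polynomial.X ^ i) = y i := by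
  rw [seqForm, Polynomial.lsum_apply, ← Polynomial.monomial_one_right_eq_X_pow,
    Polynomial.sum_monomial_index _ _ (by simp)]
  simp

theorem seqForm_map_mul_X_pow (y : ℕ → ℤ) {D : ℕ} {P : Polynomial ℤ} (hP : P.natDegree ≤ D)
    (j : ℕ) : seqForm y (P.map (Int.castRingHom ℚ) * Polynomial.X ^ j) = shiftSum y D P j := by
  conv_lhs => rw [P.as_sum_range' (D + 1) (by omega)]
  rw [Polynomial.map_sum, Finset.sum_mul, map_sum, shiftSum]
  push_cast
  refine Finset.sum_congr rfl fun i _ => ?_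
  rw [Polynomial.map_monomial, ← Polynomial.C_mul_X_pow_eq_monomial, mul_assoc, ← pow_add,
    ← Polynomial.smul_eq_C_mul, map_smul, seqForm_X_pow]
  simp

theorem annihilates_map_iff (y : ℕ → ℤ) {m D : ℕ} {P : Polynomial ℤ} (hP : P.natDegree ≤ D) :
    Annihilates y m D (P.map (Int.castRingHom ℚ)) ↔ ∀ j, j + D ≤ m → shiftSum y D P j = 0 := by
  constructor
  · intro h j hj
    have := h.2 (Polynomial.X ^ j) (by simpa using hj)
    rw [seqForm_map_mul_X_pow y hP] at this
    exact_mod_cast this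
  · intro h
    refine ⟨Polynomial.natDegree_map_le.trans hP, fun S hS => ?_⟩
    rw [S.as_sum_range, Finset.mul_sum, map_sum]
    refine Finset.sum_eq_zero fun j hj => ?_
    rw [← Polynomial.C_mul_X_pow_eq_monomial, mul_left_comm, ← Polynomial.smul_eq_C_mul, map_smul,
      seqForm_map_mul_X_pow y hP, h j (by rw [Finset.mem_range] at hj; omega)]
    simp

theorem Annihilates.smul {y : ℕ → ℤ} {m D : ℕ} {P : Polynomial ℚ} (h : Annihilates y m D P)
    (c : ℚ) : Annihilates y m D (c • P) :=
  ⟨(Polynomial.natDegree_smul_le c P).trans h.1, fun S hS => by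
    rw [smul_mul_assoc, map_smul, h.2 S hS, smul_zero]⟩

/-- If `P` and `R` annihilate `y 0, …, y m` and the sum of their degrees is at most `m + 1`, then
so does their greatest common divisor, because the multiples of the gcd of degree at most `m` are
combinations of multiples of `P` and `R` of degree at most `m`. -/
theorem Annihilates.gcd {y : ℕ → ℤ} {m D : ℕ} {P R : Polynomial ℚ} (hP : Annihilates y m D P)
    (hP0 : P ≠ 0) (hR : Annihilates y m R.natDegree R) (hR0 : R ≠ 0)
    (hD : D + R.natDegree ≤ m + 1) :
    Annihilates y m (EuclideanDomain.gcd P R).natDegree (EuclideanDomain.gcd P R) := by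
  set G := EuclideanDomain.gcd P R with hG
  obtain ⟨P₁, hP₁⟩ : G ∣ P := EuclideanDomain.gcd_dvd_left P R
  obtain ⟨R₁, hR₁⟩ : G ∣ R := EuclideanDomain.gcd_dvd_right P R
  have hG0 : G ≠ 0 := by rintro h; rw [h, zero_mul] at hP₁; exact hP0 hP₁
  have hP₁0 : P₁ ≠ 0 := by rintro rfl; rw [mul_zero] at hP₁; exact hP0 hP₁
  have hR₁0 : R₁ ≠ 0 := by rintro rfl; rw [mul_zero] at hR₁; exact hR0 hR₁
  set a := EuclideanDomain.gcdA P R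
  set b := EuclideanDomain.gcdB P R
  have hab : P₁ * a + R₁ * b = 1 := by
    have h : G * (P₁ * a + R₁ * b) = G * 1 := by
      rw [mul_one, mul_add, ← mul_assoc, ← mul_assoc, ← hP₁, ← hR₁]
      exact (EuclideanDomain.gcd_eq_gcd_ab P R).symm
    exact mul_left_cancel₀ hG0 h
  have hdP : P.natDegree = G.natDegree + P₁.natDegree := by
    conv_lhs => rw [hP₁]
    exact Polynomial.natDegree_mul hG0 hP₁0
  have hdR : R.natDegree = G.natDegree + R₁.natDegree := by
    conv_lhs => rw [hR₁]
    exact Polynomial.natDegree_mul hG0 hR₁0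
  have hPD := hP.1
  refine ⟨le_rfl, fun S hS => ?_⟩
  set A := (S * a) % R₁ with hA
  set B := S * b + (S * a) / R₁ * P₁ with hB
  have hdec : S = A * P₁ + R₁ * B := by
    have h1 := EuclideanDomain.div_add_mod (S * a) R₁
    calc S = S * (P₁ * a + R₁ * b) := by rw [hab, mul_one]
      _ = (R₁ * ((S * a) / R₁) + A) * P₁ + R₁ * (S * b) := by rw [h1]; ring
      _ = _ := by rw [hB]; ring
  have hA' : A = 0 ∨ A.natDegree < R₁.natDegree := by
    by_cases h : R₁.natDegree = 0
    · left
      rw [hA, EuclideanDomain.mod_eq_zero]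
      exact (Polynomial.isUnit_iff_degree_eq_zero.2 (by
        rw [Polynomial.degree_eq_natDegree hR₁0, h]; rfl)).dvd
    · exact Or.inr (Polynomial.natDegree_mod_lt _ h)
  have hGS : G * S = P * A + R * B := by
    conv_rhs => rw [hP₁, hR₁]
    rw [hdec]; ring
  rw [hGS, map_add]
  have h1 : seqForm y (P * A) = 0 := by
    rcases hA' with h | h
    · rw [h, mul_zero, map_zero]
    · exact hP.2 A (by omega)
  have h2 : seqForm y (R * B) = 0 := by
    by_cases hB0 : B = 0
    · rw [hB0, mul_zero, map_zero]
    · apply hR.2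
      have h3 : (R₁ * B).natDegree = R₁.natDegree + B.natDegree :=
        Polynomial.natDegree_mul hR₁0 hB0
      have h4 : R₁ * B = S - A * P₁ := by rw [hdec]; ring
      have h5 : (R₁ * B).natDegree ≤ m - G.natDegree := by
        rw [h4]
        refine (Polynomial.natDegree_sub_le _ _).trans (max_le (by omega) ?_)
        rcases hA' with h | h
        · rw [h, zero_mul]; simp
        · refine Polynomial.natDegree_mul_le.trans ?_
          omega
      omega
  rw [h1, h2, add_zero]

/-- An annihilator of minimal degree divides every annihilator of complementary degree. -/
theorem Annihilates.dvd {y : ℕ → ℤ} {m D : ℕ} {P R : Polynomial ℚ} (hP : Annihilates y m D P)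
    (hP0 : P ≠ 0) (hmin : ∀ D' < D, ∀ Q, Q ≠ 0 → ¬ Annihilates y m D' Q)
    (hR : Annihilates y m R.natDegree R) (hR0 : R ≠ 0) (hD : D + R.natDegree ≤ m + 1) : P ∣ R := by
  have hG := hP.gcd hP0 hR hR0 hD
  have hdvd : EuclideanDomain.gcd P R ∣ P := EuclideanDomain.gcd_dvd_left P R
  have hG0 : EuclideanDomain.gcd P R ≠ 0 := fun h => hP0 (by
    rw [h] at hdvd; exact zero_dvd_iff.1 hdvd)
  have hge : P.natDegree ≤ (EuclideanDomain.gcd P R).natDegree := by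
    by_contra! hlt
    exact hmin _ (lt_of_lt_of_le hlt hP.1) _ hG0 hG
  exact (Polynomial.associated_of_dvd_of_natDegree_le hdvd hP0 hge).symm.dvd.trans
    (EuclideanDomain.gcd_dvd_right P R)

theorem exists_isPrimitive_smul {P : Polynomial ℚ} (hP : P ≠ 0) : ∃ (G : Polynomial ℤ) (c : ℚ),
    G.IsPrimitive ∧ G ≠ 0 ∧ G.map (Int.castRingHom ℚ) = c • P := by
  obtain ⟨b, hb, hbP⟩ := IsLocalization.integerNormalization_spec (nonZeroDivisors ℤ) P
  set I := IsLocalization.integerNormalization (nonZeroDivisors ℤ) P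
  have hb0 : b ≠ 0 := nonZeroDivisors.ne_zero hb
  have hI0 : I ≠ 0 := by
    intro h
    rw [h, Polynomial.map_zero] at hbP
    exact (smul_ne_zero hb0 hP) hbP.symm
  have hc0 : (I.content : ℚ) ≠ 0 := by
    exact_mod_cast (Polynomial.content_eq_zero_iff.not.2 hI0)
  refine ⟨I.primPart, (I.content : ℚ)⁻¹ * b, I.isPrimitive_primPart, I.primPart_ne_zero, ?_⟩
  have h1 : (I.content : ℚ) • I.primPart.map (Int.castRingHom ℚ) = (b : ℚ) • P := by
    rw [Int.cast_smul_eq_zsmul ℚ b P, ← hbP]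
    conv_rhs => rw [I.eq_C_content_mul_primPart]
    rw [Polynomial.map_mul, Polynomial.map_C, ← Polynomial.smul_eq_C_mul]
    rfl
  rw [mul_smul, ← h1, smul_smul, inv_mul_cancel₀ hc0, one_smul]

/-- Annihilating a point close to the curve is nearly the same as vanishing at `ζ`. -/
theorem abs_shiftSum_sub_le {m D j : ℕ} (hj : j + D ≤ m) (ζ : ℝ) (q : ℕ) {P : Polynomial ℤ}
    (hP : P.natDegree ≤ D) {H : ℝ} (hH : ∀ i, |(P.coeff i : ℝ)| ≤ H) :
    |(shiftSum (approxVec ζ q) D P j : ℝ) - q * (ζ ^ j * Polynomial.aeval ζ P)| ≤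
      (D + 1) * H * approxErr m ζ q := by
  have h1 : (shiftSum (approxVec ζ q) D P j : ℝ) - q * (ζ ^ j * Polynomial.aeval ζ P) =
      ∑ i ∈ Finset.range (D + 1),
        (P.coeff i : ℝ) * -(ζ ^ (i + j) * q - approxVec ζ q (i + j)) := by
    rw [Polynomial.aeval_eq_sum_range' (Nat.lt_succ_iff.2 hP), shiftSum, Finset.mul_sum,
      Finset.mul_sum]
    push_cast
    rw [← Finset.sum_sub_distrib]
    refine Finset.sum_congr rfl fun i _ => ?_
    rw [zsmul_eq_mul, pow_add]
    ring
  rw [h1]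
  refine (Finset.abs_sum_le_sum_abs _ _).trans ?_
  have hH0 : 0 ≤ H := (abs_nonneg _).trans (hH 0)
  calc _ ≤ ∑ i ∈ Finset.range (D + 1), H * approxErr m ζ q := by
        refine Finset.sum_le_sum fun i hi => ?_
        rw [Finset.mem_range] at hi
        rw [abs_mul, abs_neg]
        exact mul_le_mul (hH i) (abs_sub_approxVec_le (by omega) ζ q) (abs_nonneg _) hH0
    _ = _ := by rw [Finset.sum_const, Finset.card_range, nsmul_eq_mul]; push_cast; ring

/-- Dirichlet's theorem for polynomials: small values at `ζ` with small integer coefficients. -/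
theorem exists_polynomial_small (ζ : ℝ) {D B : ℕ} (hD : 1 ≤ D) (hB : 1 ≤ B) :
    ∃ R : Polynomial ℤ, R ≠ 0 ∧ R.natDegree ≤ D ∧ (∀ i, |R.coeff i| ≤ B) ∧
      |Polynomial.aeval ζ R| ≤ 2 * ((D + 1) * max 1 |ζ| ^ D) / (B : ℝ) ^ D := by
  classical
  have hBR : (0 : ℝ) < B := by exact_mod_cast hB
  set A : ℝ := max 1 |ζ| ^ D with hA
  have hA0 : 0 < A := by positivity
  have hpow : ∀ i : Fin (D + 1), |ζ ^ (i : ℕ)| ≤ A := fun i => by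
    rw [abs_pow]
    calc |ζ| ^ (i : ℕ) ≤ max 1 |ζ| ^ (i : ℕ) := by gcongr; exact le_max_right _ _
      _ ≤ A := pow_le_pow_right₀ (le_max_left _ _) (Nat.lt_succ_iff.1 i.2)
  set W : ℝ := (D + 1) * A * B with hW
  have hW0 : 0 < W := by positivity
  set w : ℝ := 2 * W / (B : ℝ) ^ (D + 1) with hw
  have hw0 : 0 < w := by positivity
  let v : (Fin (D + 1) → Fin (B + 1)) → ℝ := fun f => ∑ i, ((f i : ℕ) : ℝ) * ζ ^ (i : ℕ)
  have hv : ∀ f, |v f| ≤ W := fun f => by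
    refine (Finset.abs_sum_le_sum_abs _ _).trans ?_
    calc _ ≤ ∑ i : Fin (D + 1), (B : ℝ) * A := by
          refine Finset.sum_le_sum fun i _ => ?_
          rw [abs_mul, Nat.abs_cast]
          have : ((f i : ℕ) : ℝ) ≤ B := by exact_mod_cast Nat.lt_succ_iff.1 (f i).2
          exact mul_le_mul this (hpow i) (abs_nonneg _) hBR.le
      _ = W := by
          rw [Finset.sum_const, Finset.card_univ, Fintype.card_fin, nsmul_eq_mul, hW]
          push_cast; ring
  have hcard : (Finset.range (B ^ (D + 1) + 1)).card <
      (Finset.univ : Finset (Fin (D + 1) → Fin (B + 1))).card := by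
    rw [Finset.card_range, Finset.card_univ, Fintype.card_fun, Fintype.card_fin, Fintype.card_fin]
    have h1 : 1 < (B + 1) ^ D := Nat.one_lt_pow (by omega) (by omega)
    have h2 : B ^ D ≤ (B + 1) ^ D := Nat.pow_le_pow_left (by omega) D
    calc B ^ (D + 1) + 1 = B ^ D * B + 1 := by rw [pow_succ]
      _ ≤ (B + 1) ^ D * B + 1 := by gcongr
      _ < (B + 1) ^ D * B + (B + 1) ^ D := by omega
      _ = (B + 1) ^ (D + 1) := by ring
  obtain ⟨f, -, g, -, hfg, hbox⟩ := Finset.exists_ne_map_eq_of_card_lt_of_maps_to hcard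
    (f := fun f => ⌊(v f + W) / w⌋₊) (by
      intro f _
      simp only [Finset.coe_range, Set.mem_Iio]
      rw [Nat.lt_succ_iff]
      refine Nat.floor_le_of_le ?_
      rw [div_le_iff₀ hw0, hw]
      have := (abs_le.1 (hv f)).2
      push_cast
      rw [mul_div_cancel₀ _ (by positivity)]
      linarith)
  refine ⟨∑ i : Fin (D + 1), Polynomial.monomial (i : ℕ) (((f i : ℕ) : ℤ) - ((g i : ℕ) : ℤ)),
    ?_, ?_, ?_, ?_⟩
  · intro h
    apply hfg
    ext i
    have := congrArg (fun p => Polynomial.coeff p (i : ℕ)) h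
    simp only [Polynomial.finsetSum_coeff, Polynomial.coeff_monomial, Fin.val_inj,
      Finset.sum_ite_eq', Finset.mem_univ, if_true, Polynomial.coeff_zero] at this
    omega
  · refine Polynomial.natDegree_sum_le_of_forall_le _ _ fun i _ => ?_
    exact (Polynomial.natDegree_monomial_le _).trans (Nat.lt_succ_iff.1 i.2)
  · intro i
    rw [Polynomial.finsetSum_coeff]
    by_cases hi : i < D + 1
    · rw [Finset.sum_eq_single (⟨i, hi⟩ : Fin (D + 1))]
      · rw [Polynomial.coeff_monomial, if_pos rfl]
        have h1 := (f ⟨i, hi⟩).2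
        have h2 := (g ⟨i, hi⟩).2
        rw [abs_le]
        omega
      · intro k _ hk
        rw [Polynomial.coeff_monomial, if_neg]
        rintro rfl
        exact hk rfl
      · simp
    · rw [Finset.sum_eq_zero]
      · simp
      · intro k _
        rw [Polynomial.coeff_monomial, if_neg]
        have := k.2
        omega
  · have h1 : Polynomial.aeval ζ (∑ i : Fin (D + 1),
        Polynomial.monomial (i : ℕ) (((f i : ℕ) : ℤ) - ((g i : ℕ) : ℤ))) = v f - v g := by
      rw [map_sum]
      simp only [Polynomial.aeval_monomial, v]
      rw [← Finset.sum_sub_distrib]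
      refine Finset.sum_congr rfl fun i _ => ?_
      simp [sub_mul]
    rw [h1]
    have hf0 : 0 ≤ (v f + W) / w := div_nonneg (by linarith [(abs_le.1 (hv f)).1]) hw0.le
    have hg0 : 0 ≤ (v g + W) / w := div_nonneg (by linarith [(abs_le.1 (hv g)).1]) hw0.le
    have h2 : |(v f + W) / w - (v g + W) / w| ≤ 1 := by
      have a1 := Nat.floor_le hf0
      have a2 := Nat.floor_le hg0
      have a3 := Nat.lt_floor_add_one ((v f + W) / w)
      have a4 := Nat.lt_floor_add_one ((v g + W) / w)
      rw [hbox] at a1 a3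
      rw [abs_le]
      constructor <;> linarith
    rw [← sub_div, add_sub_add_right_eq_sub, abs_div, abs_of_pos hw0, div_le_iff₀ hw0, one_mul]
      at h2
    refine h2.trans (le_of_eq ?_)
    rw [hw, hW]
    field_simp
    ring

/-! ### Best approximations have no annihilators of small degree -/

theorem abs_pow_le_max_pow {ζ : ℝ} {j m : ℕ} (hj : j ≤ m) : |ζ ^ j| ≤ max 1 |ζ| ^ m := by
  rw [abs_pow]
  calc |ζ| ^ j ≤ max 1 |ζ| ^ j := by gcongr; exact le_max_right _ _
    _ ≤ _ := pow_le_pow_right₀ (le_max_left _ _) hj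

theorem eventually_mul_rpow_lt {C e ε : ℝ} (he : e < 0) (hε : 0 < ε) :
    ∀ᶠ Q : ℝ in atTop, C * Q ^ e < ε := by
  have h : Tendsto (fun Q : ℝ => C * Q ^ e) atTop (nhds (C * 0)) := by
    have := tendsto_rpow_neg_atTop (neg_pos.2 he)
    rw [neg_neg] at this
    exact this.const_mul C
  rw [mul_zero] at h
  exact h.eventually_lt_const hε

/-- For `1 / (n + 1) < β < μ` and every large `Q`, Dirichlet's theorem yields a polynomial of degree
at most `n + 1` and height at most `Q ^ β` that annihilates every approximation with denominator
at most `Q` and error at most `Q ^ (-μ)`. -/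
theorem eventually_exists_annihilates (ζ : ℝ) {n : ℕ} {β μ : ℝ}
    (hβ : 1 / ((n : ℝ) + 1) < β) (hβμ : β < μ) :
    ∀ᶠ Q : ℝ in atTop, ∃ R : Polynomial ℤ, R ≠ 0 ∧ R.natDegree ≤ n + 1 ∧
      (∀ i, |(R.coeff i : ℝ)| ≤ Q ^ β) ∧
      ∀ p : ℕ, (p : ℝ) ≤ Q → approxErr (2 * n) ζ p ≤ Q ^ (-μ) →
        Annihilates (approxVec ζ p) (2 * n) R.natDegree (R.map (Int.castRingHom ℚ)) := by
  have hn : (0 : ℝ) < (n : ℝ) + 1 := by positivity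
  have hβ0 : 0 < β := lt_trans (by positivity) hβ
  have hexp : 1 - β * ((n + 1 : ℕ) : ℝ) < 0 := by
    rw [div_lt_iff₀ hn] at hβ
    push_cast
    linarith
  set A : ℝ := max 1 |ζ| ^ (2 * n) with hA
  set C : ℝ := 2 * ((((n + 1 : ℕ) : ℝ) + 1) * max 1 |ζ| ^ (n + 1)) with hC
  have hA0 : 0 < A := by positivity
  have hC0 : 0 < C := by positivity
  filter_upwards [eventually_ge_atTop 1,
    eventually_mul_rpow_lt (C := (n : ℝ) + 2) (sub_neg.2 hβμ) (half_pos one_pos),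
    eventually_mul_rpow_lt (C := A * (C * 2 ^ (n + 1))) hexp (half_pos one_pos)] with Q hQ hQ1 hQ2
  have hQ0 : 0 < Q := by linarith
  have hQβ : 1 ≤ Q ^ β := Real.one_le_rpow hQ hβ0.le
  set B := ⌊Q ^ β⌋₊ with hB
  have hB1 : 1 ≤ B := Nat.le_floor (by exact_mod_cast hQβ)
  have hBle : (B : ℝ) ≤ Q ^ β := Nat.floor_le (by linarith)
  have hB2 : Q ^ β / 2 ≤ B := by
    have h1 := Nat.lt_floor_add_one (Q ^ β)
    have h2 : (1 : ℝ) ≤ B := by exact_mod_cast hB1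
    rw [← hB] at h1
    linarith
  obtain ⟨R, hR0, hRd, hRc, hRζ⟩ := exists_polynomial_small ζ (D := n + 1) (by omega) hB1
  have hRcR : ∀ i, |(R.coeff i : ℝ)| ≤ Q ^ β := fun i => by
    refine le_trans ?_ hBle
    exact_mod_cast hRc i
  refine ⟨R, hR0, hRd, hRcR, fun p hp hpL => ?_⟩
  rw [annihilates_map_iff _ le_rfl]
  intro j hj
  have h1 := abs_shiftSum_sub_le hj ζ p le_rfl hRcR
  have h2 : ((R.natDegree : ℝ) + 1) * Q ^ β * approxErr (2 * n) ζ p < 1 / 2 := by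
    have hd : (R.natDegree : ℝ) + 1 ≤ (n : ℝ) + 2 := by
      have : (R.natDegree : ℝ) ≤ (n + 1 : ℕ) := by exact_mod_cast hRd
      push_cast at this
      linarith
    have hnn := approxErr_nonneg (2 * n) ζ p
    calc _ ≤ ((n : ℝ) + 2) * Q ^ β * Q ^ (-μ) := by gcongr
      _ = ((n : ℝ) + 2) * Q ^ (β - μ) := by rw [mul_assoc, ← Real.rpow_add hQ0]; rfl
      _ < _ := hQ1
  have h3 : |(p : ℝ) * (ζ ^ j * Polynomial.aeval ζ R)| < 1 / 2 := by
    rw [abs_mul, abs_mul, Nat.abs_cast]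
    have e1 : |Polynomial.aeval ζ R| ≤ C * 2 ^ (n + 1) * Q ^ (-(β * ((n + 1 : ℕ) : ℝ))) := by
      refine hRζ.trans ?_
      calc C / (B : ℝ) ^ (n + 1) ≤ C / (Q ^ β / 2) ^ (n + 1) := by gcongr
        _ = _ := by
          rw [Real.rpow_neg hQ0.le, Real.rpow_mul hQ0.le, Real.rpow_natCast, div_pow]
          field_simp
    have e2 : |ζ ^ j| ≤ A := abs_pow_le_max_pow (by omega)
    calc (p : ℝ) * (|ζ ^ j| * |Polynomial.aeval ζ R|)
        ≤ Q * (A * (C * 2 ^ (n + 1) * Q ^ (-(β * ((n + 1 : ℕ) : ℝ))))) := by gcongr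
      _ = A * (C * 2 ^ (n + 1)) * Q ^ (1 - β * ((n + 1 : ℕ) : ℝ)) := by
          rw [sub_eq_add_neg, Real.rpow_add hQ0, Real.rpow_one]; ring
      _ < _ := hQ2
  have h4 : |(shiftSum (approxVec ζ p) R.natDegree R j : ℝ)| < 1 := by
    have := abs_sub_abs_le_abs_sub (shiftSum (approxVec ζ p) R.natDegree R j : ℝ)
      (p * (ζ ^ j * Polynomial.aeval ζ R))
    linarith
  rw [← Int.abs_lt_one_iff]
  exact_mod_cast h4

theorem mahlerMeasure_map_le {R : Polynomial ℤ} {d : ℕ} (hd : R.natDegree ≤ d) {H : ℝ}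
    (hH : ∀ i, |(R.coeff i : ℝ)| ≤ H) :
    (R.map (Int.castRingHom ℂ)).mahlerMeasure ≤ (d + 1) * H := by
  refine (Polynomial.mahlerMeasure_le_sum_norm_coeff _).trans ?_
  rw [Polynomial.sum_over_range' _ (fun _ => norm_zero) (d + 1)
    (Nat.lt_succ_iff.2 (Polynomial.natDegree_map_le.trans hd))]
  calc _ ≤ ∑ _i ∈ Finset.range (d + 1), H := Finset.sum_le_sum fun i _ => by
        simpa [Polynomial.coeff_map, Complex.norm_intCast] using hH i
    _ = _ := by rw [Finset.sum_const, Finset.card_range, nsmul_eq_mul]; push_cast; ring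

theorem abs_coeff_le_mahlerMeasure {G : Polynomial ℤ} {d : ℕ} (hd : G.natDegree ≤ d) (i : ℕ) :
    |(G.coeff i : ℝ)| ≤ 2 ^ d * (G.map (Int.castRingHom ℂ)).mahlerMeasure := by
  have h := Polynomial.norm_coeff_le_choose_mul_mahlerMeasure i (G.map (Int.castRingHom ℂ))
  have h1 : ‖(G.map (Int.castRingHom ℂ)).coeff i‖ = |(G.coeff i : ℝ)| := by
    simp [Polynomial.coeff_map, Complex.norm_intCast]
  rw [h1] at h
  refine h.trans ?_
  have h2 : ((G.map (Int.castRingHom ℂ)).natDegree.choose i : ℝ) ≤ 2 ^ d := by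
    have h3 : (G.map (Int.castRingHom ℂ)).natDegree.choose i ≤ 2 ^ d :=
      (Nat.choose_le_two_pow _ _).trans
        (Nat.pow_le_pow_right two_pos (Polynomial.natDegree_map_le.trans hd))
    exact_mod_cast h3
  exact mul_le_mul_of_nonneg_right h2 (Polynomial.mahlerMeasure_nonneg _)

theorem mahlerMeasure_le_of_dvd {G R : Polynomial ℤ} (h : G ∣ R) (hR : R ≠ 0) :
    (G.map (Int.castRingHom ℂ)).mahlerMeasure ≤ (R.map (Int.castRingHom ℂ)).mahlerMeasure := by
  obtain ⟨S, rfl⟩ := h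
  have hS : S ≠ 0 := right_ne_zero_of_mul hR
  rw [Polynomial.map_mul, Polynomial.mahlerMeasure_mul]
  exact le_mul_of_one_le_right (Polynomial.mahlerMeasure_nonneg _)
    (Polynomial.one_le_mahlerMeasure_of_ne_zero hS)

/-- If the uniform exponent of `ζ, …, ζ ^ (2 * n)` exceeds `1 / (n + 1)`, then no best
approximation with a large denominator is annihilated by a form of degree at most `n`.

Induction on the degree `D`. A primitive annihilator `G` of minimal degree of the best approximation
with denominator `q (k + 1)` divides the polynomial of degree at most `n + 1` that Dirichlet's
theorem provides for this denominator, so its height is small enough for `G` to annihilate the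
preceding best approximation as well. Descending to a fixed index bounds the height of `G`, which
leaves finitely many `G`, while `G` takes arbitrarily small values at `ζ`. -/
theorem IsRecordSeq.eventually_not_annihilates {n : ℕ} {ζ μ : ℝ} (hζ : Transcendental ℚ ζ)
    {q : ℕ → ℕ} (hq : IsRecordSeq (approxErr (2 * n) ζ) q) (hμ : 1 / ((n : ℝ) + 1) < μ)
    (hL : ∀ᶠ k in atTop, approxErr (2 * n) ζ (q k) ≤ (q (k + 1) : ℝ) ^ (-μ)) :
    ∀ D ≤ n + 1, ∀ᶠ k in atTop, ∀ D' < D, ∀ P : Polynomial ℚ, P ≠ 0 →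
      ¬ Annihilates (approxVec ζ (q k)) (2 * n) D' P := by
  intro D
  induction D with
  | zero => exact fun _ => Eventually.of_forall fun k D' hD' => absurd hD' (by omega)
  | succ d ih =>
    intro hd
    have hdn : d ≤ n := by omega
    obtain ⟨β, hβ1, hβ2⟩ := exists_between hμ
    have hqt : Tendsto (fun k => (q k : ℝ)) atTop atTop :=
      tendsto_natCast_atTop_atTop.comp hq.strictMono.tendsto_atTop
    set A : ℝ := max 1 |ζ| ^ (2 * n) with hA
    have hA0 : 0 < A := by positivity
    -- the height bound for an annihilator
    let M : ℝ → ℝ := fun Q => ((n : ℝ) + 2) * Q ^ β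
    have hev : ∀ᶠ k in atTop, (∀ D' < d, ∀ P : Polynomial ℚ, P ≠ 0 →
          ¬ Annihilates (approxVec ζ (q k)) (2 * n) D' P) ∧
        approxErr (2 * n) ζ (q k) ≤ (q (k + 1) : ℝ) ^ (-μ) ∧
        (∃ R : Polynomial ℤ, R ≠ 0 ∧ R.natDegree ≤ n + 1 ∧
          (∀ i, |(R.coeff i : ℝ)| ≤ (q (k + 1) : ℝ) ^ β) ∧
          ∀ p : ℕ, (p : ℝ) ≤ q (k + 1) → approxErr (2 * n) ζ p ≤ (q (k + 1) : ℝ) ^ (-μ) →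
            Annihilates (approxVec ζ p) (2 * n) R.natDegree (R.map (Int.castRingHom ℚ))) ∧
        (((n : ℝ) + 1) * (1 + A) * (2 ^ n * ((n : ℝ) + 2))) * (q (k + 1) : ℝ) ^ (β - μ) < 1 := by
      have hqt1 := (tendsto_add_atTop_iff_nat 1).2 hqt
      filter_upwards [ih (by omega), hL, hqt1.eventually (eventually_exists_annihilates ζ hβ1 hβ2),
        hqt1.eventually (eventually_mul_rpow_lt (sub_neg.2 hβ2) one_pos)] with k h1 h2 h3 h4
      exact ⟨h1, h2, h3, h4⟩
    obtain ⟨K, hK⟩ := eventually_atTop.1 hev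
    -- the descent from one best approximation to the preceding one
    have hstep : ∀ k, K ≤ k → ∀ G : Polynomial ℤ, G.IsPrimitive → G ≠ 0 → G.natDegree ≤ d →
        Annihilates (approxVec ζ (q (k + 1))) (2 * n) d (G.map (Int.castRingHom ℚ)) →
        (G.map (Int.castRingHom ℂ)).mahlerMeasure ≤ M (q (k + 1)) ∧
        Annihilates (approxVec ζ (q k)) (2 * n) d (G.map (Int.castRingHom ℚ)) := by
      intro k hk G hGp hG0 hGd hG
      obtain ⟨-, hLk, ⟨R, hR0, hRd, hRc, hRann⟩, hsmall⟩ := hK k hk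
      have hmin := (hK (k + 1) (by omega)).1
      have hanti := (hq.anti k).le
      have hinj : Function.Injective (Int.castRingHom ℚ) := (Int.castRingHom ℚ).injective_int
      have hRdeg : (R.map (Int.castRingHom ℚ)).natDegree = R.natDegree :=
        Polynomial.natDegree_map_eq_of_injective hinj R
      have hGR : G ∣ R := by
        rw [Polynomial.IsPrimitive.Int.dvd_iff_map_cast_dvd_map_cast G R hGp]
        refine hG.dvd ((Polynomial.map_ne_zero_iff hinj).2 hG0) hmin ?_
          ((Polynomial.map_ne_zero_iff hinj).2 hR0) (by omega)
        rw [hRdeg]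
        exact hRann _ le_rfl (hanti.trans hLk)
      have hMG : (G.map (Int.castRingHom ℂ)).mahlerMeasure ≤ M (q (k + 1)) := by
        refine (mahlerMeasure_le_of_dvd hGR hR0).trans ((mahlerMeasure_map_le hRd hRc).trans ?_)
        simp only [M]
        push_cast
        exact le_of_eq (by ring)
      refine ⟨hMG, ?_⟩
      set Q : ℝ := (q (k + 1) : ℝ) with hQ
      have hQ0 : 0 < Q := by have := hq.one_le (k + 1); rw [hQ]; exact_mod_cast this
      set H : ℝ := 2 ^ n * M Q with hH
      have hH0 : 0 ≤ H := by positivity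
      have hGc : ∀ i, |(G.coeff i : ℝ)| ≤ H := fun i =>
        (abs_coeff_le_mahlerMeasure (hGd.trans hdn) i).trans
          (mul_le_mul_of_nonneg_left hMG (by positivity))
      set ℓ := approxErr (2 * n) ζ (q k) with hℓ
      have hd1 : (d : ℝ) + 1 ≤ (n : ℝ) + 1 := by
        have : (d : ℝ) ≤ n := by exact_mod_cast hdn
        linarith
      have hℓ0 : 0 ≤ ℓ := approxErr_nonneg _ _ _
      have hval : (q k : ℝ) * |Polynomial.aeval ζ G| ≤ ((n : ℝ) + 1) * H * ℓ := by
        have h0 := (annihilates_map_iff (approxVec ζ (q (k + 1))) hGd).1 hG 0 (by omega)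
        have h1 := abs_shiftSum_sub_le (m := 2 * n) (j := 0) (by omega) ζ (q (k + 1)) hGd hGc
        rw [h0, pow_zero, one_mul, Int.cast_zero, zero_sub, abs_neg, abs_mul, Nat.abs_cast] at h1
        have h2 : (q k : ℝ) ≤ q (k + 1) := by
          exact_mod_cast (hq.strictMono (Nat.lt_succ_self k)).le
        have hnn := approxErr_nonneg (2 * n) ζ (q (k + 1))
        calc (q k : ℝ) * |Polynomial.aeval ζ G| ≤ q (k + 1) * |Polynomial.aeval ζ G| := by gcongr
          _ ≤ _ := h1
          _ ≤ _ := by gcongr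
      rw [annihilates_map_iff _ hGd]
      intro j hj
      have h1 := abs_shiftSum_sub_le hj ζ (q k) hGd hGc
      have h2 : |(q k : ℝ) * (ζ ^ j * Polynomial.aeval ζ G)| ≤ A * (((n : ℝ) + 1) * H * ℓ) := by
        rw [mul_left_comm, abs_mul, abs_mul, Nat.abs_cast]
        exact mul_le_mul (abs_pow_le_max_pow (by omega)) hval (by positivity) hA0.le
      have h3 : ((d : ℝ) + 1) * H * ℓ ≤ ((n : ℝ) + 1) * H * ℓ := by gcongr
      have h4 : ((n : ℝ) + 1) * H * ℓ + A * (((n : ℝ) + 1) * H * ℓ) < 1 := by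
        calc _ = (((n : ℝ) + 1) * (1 + A)) * (H * ℓ) := by ring
          _ ≤ (((n : ℝ) + 1) * (1 + A)) * (H * Q ^ (-μ)) := by gcongr
          _ = (((n : ℝ) + 1) * (1 + A) * (2 ^ n * ((n : ℝ) + 2))) * Q ^ (β - μ) := by
              rw [hH, sub_eq_add_neg, Real.rpow_add hQ0]; ring
          _ < 1 := hsmall
      have h5 : |(shiftSum (approxVec ζ (q k)) d G j : ℝ)| < 1 := by
        have := abs_sub_abs_le_abs_sub (shiftSum (approxVec ζ (q k)) d G j : ℝ)
          (q k * (ζ ^ j * Polynomial.aeval ζ G))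
        linarith
      rw [← Int.abs_lt_one_iff]
      exact_mod_cast h5
    have hdesc : ∀ t, ∀ G : Polynomial ℤ, G.IsPrimitive → G ≠ 0 → G.natDegree ≤ d →
        Annihilates (approxVec ζ (q (K + 1 + t))) (2 * n) d (G.map (Int.castRingHom ℚ)) →
        (G.map (Int.castRingHom ℂ)).mahlerMeasure ≤ M (q (K + 1)) := by
      intro t
      induction t with
      | zero => exact fun G h1 h2 h3 h4 => (hstep K le_rfl G h1 h2 h3 h4).1
      | succ t iht =>
        exact fun G h1 h2 h3 h4 => iht G h1 h2 h3 (hstep (K + 1 + t) (by omega) G h1 h2 h3 h4).2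
    set M₀ : ℝ := M (q (K + 1)) with hM0
    have hM0nn : 0 ≤ M₀ := by positivity
    have hfin := Polynomial.finite_mahlerMeasure_le d ⟨M₀, hM0nn⟩
    have hfar : ∀ᶠ k in atTop, ∀ G ∈ {p : Polynomial ℤ | p.natDegree ≤ d ∧
        (p.map (Int.castRingHom ℂ)).mahlerMeasure ≤ ((⟨M₀, hM0nn⟩ : NNReal) : ℝ)}, G ≠ 0 →
          ((d : ℝ) + 1) * (2 ^ d * M₀) < (q k : ℝ) * |Polynomial.aeval ζ G| := by
      refine (eventually_all_finite hfin).2 fun G _ => ?_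
      by_cases hG0 : G = 0
      · exact Eventually.of_forall fun k h => absurd hG0 h
      · have hne : Polynomial.aeval ζ G ≠ 0 := by
          intro h
          have hζ' := transcendental_iff.1 hζ (G.map (Int.castRingHom ℚ)) (by
            rw [← h, Polynomial.aeval_def, Polynomial.aeval_def, Polynomial.eval₂_map]
            congr 1)
          exact hG0 ((Polynomial.map_eq_zero_iff (Int.castRingHom ℚ).injective_int).1 hζ')
        filter_upwards [(hqt.atTop_mul_const (abs_pos.2 hne)).eventually_gt_atTop _] with k hk _
        exact hk
    filter_upwards [hfar, eventually_ge_atTop (K + 1)] with k hfark hkK D' hD' P hP0 hP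
    have hmin := (hK k (by omega)).1
    rcases (Nat.lt_succ_iff.1 hD').lt_or_eq with hlt | rfl
    · exact hmin D' hlt P hP0 hP
    obtain ⟨G, c, hGp, hG0, hGP⟩ := exists_isPrimitive_smul hP0
    have hGann := hP.smul c
    rw [← hGP] at hGann
    have hGd : G.natDegree ≤ D' := by
      rw [← Polynomial.natDegree_map_eq_of_injective (Int.castRingHom ℚ).injective_int G]
      exact hGann.1
    obtain ⟨t, rfl⟩ := Nat.exists_eq_add_of_le hkK
    have hMG := hdesc t G hGp hG0 hGd hGann
    have h1 := hfark G ⟨hGd, hMG⟩ hG0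
    have h0 := (annihilates_map_iff (approxVec ζ (q (K + 1 + t))) hGd).1 hGann 0 (by omega)
    have hGc : ∀ i, |(G.coeff i : ℝ)| ≤ 2 ^ D' * M₀ := fun i =>
      (abs_coeff_le_mahlerMeasure hGd i).trans (mul_le_mul_of_nonneg_left hMG (by positivity))
    have h2 := abs_shiftSum_sub_le (m := 2 * n) (j := 0) (by omega) ζ (q (K + 1 + t)) hGd hGc
    rw [h0, pow_zero, one_mul, Int.cast_zero, zero_sub, abs_neg, abs_mul, Nat.abs_cast] at h2
    have h3 := approxErr_le_one (2 * n) ζ (q (K + 1 + t))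
    have h4 : ((D' : ℝ) + 1) * (2 ^ D' * M₀) * approxErr (2 * n) ζ (q (K + 1 + t)) ≤
        ((D' : ℝ) + 1) * (2 ^ D' * M₀) := mul_le_of_le_one_right (by positivity) h3
    linarith

/-! ### Hankel determinants of best approximations -/

theorem hankel_det_ne_zero {y : ℕ → ℤ} {n : ℕ}
    (h : ∀ P : Polynomial ℚ, P ≠ 0 → ¬ Annihilates y (2 * n) n P) :
    (Matrix.of fun i j : Fin (n + 1) => y (i + j)).det ≠ 0 := by
  intro hdet
  obtain ⟨v, hv, hMv⟩ := Matrix.exists_mulVec_eq_zero_iff.2 hdet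
  set P : Polynomial ℤ := ∑ i : Fin (n + 1), Polynomial.monomial (i : ℕ) (v i) with hP
  have hcoeff : ∀ i : Fin (n + 1), P.coeff i = v i := fun i => by
    simp [hP, Polynomial.finsetSum_coeff, Polynomial.coeff_monomial, Fin.val_inj]
  have hP0 : P ≠ 0 := by
    intro h0
    apply hv
    ext i
    rw [← hcoeff, h0]
    simp
  have hdeg : P.natDegree ≤ n := by
    refine Polynomial.natDegree_sum_le_of_forall_le _ _ fun i _ => ?_
    exact (Polynomial.natDegree_monomial_le _).trans (Nat.lt_succ_iff.1 i.2)
  refine h (P.map (Int.castRingHom ℚ))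
    ((Polynomial.map_ne_zero_iff (Int.castRingHom ℚ).injective_int).2 hP0) ?_
  rw [annihilates_map_iff y hdeg]
  intro j hj
  have h1 := congrFun hMv ⟨j, by omega⟩
  simp only [Matrix.mulVec, dotProduct, Matrix.of_apply, Pi.zero_apply] at h1
  rw [shiftSum, Finset.sum_range, ← h1]
  refine Finset.sum_congr rfl fun i _ => ?_
  rw [hcoeff, mul_comm, add_comm]

theorem abs_det_le_factorial_mul_prod {N : ℕ} (A : Matrix (Fin N) (Fin N) ℝ) (b : Fin N → ℝ)
    (h : ∀ i j, |A i j| ≤ b i) : |A.det| ≤ N.factorial * ∏ i, b i := by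
  rw [Matrix.det_apply]
  refine (Finset.abs_sum_le_sum_abs _ _).trans ?_
  calc _ ≤ ∑ _σ : Equiv.Perm (Fin N), ∏ i, b i := by
        refine Finset.sum_le_sum fun σ _ => ?_
        rw [Units.smul_def, abs_zsmul]
        have h1 : |((Equiv.Perm.sign σ : ℤˣ) : ℤ)| = 1 := Int.isUnit_iff_abs_eq.1 (Units.isUnit _)
        rw [h1, one_smul, Finset.abs_prod, ← Equiv.prod_comp σ b]
        exact Finset.prod_le_prod (fun i _ => abs_nonneg _) fun i _ => h _ _
    _ = _ := by
        rw [Finset.sum_const, Finset.card_univ, Fintype.card_perm, Fintype.card_fin, nsmul_eq_mul]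

/-- A nonzero Hankel determinant bounds the quality of an approximation from below: subtracting
`ζ ^ i` times the first row from the `i`-th one makes all rows but the first small. -/
theorem one_le_mul_approxErr_pow {n : ℕ} {ζ : ℝ} {q : ℕ} (hq : 1 ≤ q)
    (hdet : (Matrix.of fun i j : Fin (n + 1) => approxVec ζ q (i + j)).det ≠ 0) :
    1 ≤ ((n + 1).factorial : ℝ) * (1 + max 1 |ζ| ^ (2 * n)) ^ (n + 1) *
      (q * approxErr (2 * n) ζ q ^ n) := by
  set A : ℝ := max 1 |ζ| ^ (2 * n) with hA
  set L := approxErr (2 * n) ζ q with hL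
  have hA0 : 0 < A := by positivity
  have hL0 : 0 ≤ L := approxErr_nonneg _ _ _
  have hqR : (1 : ℝ) ≤ q := by exact_mod_cast hq
  set y : ℕ → ℝ := fun i => approxVec ζ q i with hy
  let B : Matrix (Fin (n + 1)) (Fin (n + 1)) ℝ := Matrix.of fun i j =>
    if i = 0 then y j else y (i + j) - ζ ^ (i : ℕ) * y j
  have hdetB : ((Matrix.of fun i j : Fin (n + 1) => approxVec ζ q (i + j)).det : ℝ) = B.det := by
    rw [Int.cast_det]
    refine Matrix.det_eq_of_forall_row_eq_smul_add_const
      (fun i => if i = 0 then 0 else ζ ^ (i : ℕ)) 0 (by simp) fun i j => ?_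
    by_cases hi : i = 0
    · subst hi; simp [B, y]
    · simp [B, y, hi]
  have hyL : ∀ i ≤ 2 * n, |ζ ^ i * q - y i| ≤ L := fun i hi => abs_sub_approxVec_le hi ζ q
  have hle := abs_det_le_factorial_mul_prod B
    (fun i => if i = 0 then (1 + A) * q else (1 + A) * L) (by
      intro i j
      have hj := hyL j (by omega)
      have hAj : |ζ ^ (j : ℕ)| ≤ A := abs_pow_le_max_pow (by omega)
      have hAi : |ζ ^ (i : ℕ)| ≤ A := abs_pow_le_max_pow (by omega)
      by_cases hi : i = 0
      · simp only [B, Matrix.of_apply, if_pos hi]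
        have h1 : |y j| ≤ |ζ ^ (j : ℕ) * q| + |ζ ^ (j : ℕ) * q - y j| := by
          have := abs_sub (ζ ^ (j : ℕ) * q) (ζ ^ (j : ℕ) * q - y j)
          rwa [sub_sub_cancel] at this
        have h2 : |ζ ^ (j : ℕ) * q| ≤ A * q := by
          rw [abs_mul, Nat.abs_cast]; gcongr
        have h3 : L ≤ 1 := approxErr_le_one _ _ _
        linarith
      · simp only [B, Matrix.of_apply, if_neg hi]
        have hij := hyL (i + j) (by omega)
        have h1 : y (i + j) - ζ ^ (i : ℕ) * y j =
            ζ ^ (i : ℕ) * (ζ ^ (j : ℕ) * q - y j) - (ζ ^ ((i : ℕ) + j) * q - y (i + j)) := by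
          rw [pow_add]; ring
        rw [h1]
        refine (abs_sub _ _).trans ?_
        rw [abs_mul]
        have h2 : |ζ ^ (i : ℕ)| * |ζ ^ (j : ℕ) * q - y j| ≤ A * L := by gcongr
        linarith)
  rw [← hdetB] at hle
  have h1 : (1 : ℝ) ≤
      |((Matrix.of fun i j : Fin (n + 1) => approxVec ζ q (i + j)).det : ℝ)| := by
    exact_mod_cast Int.one_le_abs hdet
  refine h1.trans (hle.trans (le_of_eq ?_))
  rw [Fin.prod_univ_succ]
  simp only [if_true, Fin.succ_ne_zero, if_false, Finset.prod_const, Finset.card_univ,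
    Fintype.card_fin]
  rw [mul_pow]
  ring

theorem IsRecordSeq.exists_one_le_mul {n : ℕ} {ζ μ : ℝ} (hζ : Transcendental ℚ ζ)
    {q : ℕ → ℕ} (hq : IsRecordSeq (approxErr (2 * n) ζ) q) (hμ : 1 / ((n : ℝ) + 1) < μ)
    (hL : ∀ᶠ k in atTop, approxErr (2 * n) ζ (q k) ≤ (q (k + 1) : ℝ) ^ (-μ)) :
    ∃ C : ℝ, 0 < C ∧ ∀ᶠ k in atTop, 1 ≤ C * (q k * approxErr (2 * n) ζ (q k) ^ n) := by
  refine ⟨((n + 1).factorial : ℝ) * (1 + max 1 |ζ| ^ (2 * n)) ^ (n + 1), by positivity, ?_⟩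
  filter_upwards [hq.eventually_not_annihilates hζ hμ hL (n + 1) le_rfl] with k hk
  exact one_le_mul_approxErr_pow (hq.one_le k) (hankel_det_ne_zero (hk n (Nat.lt_succ_self n)))

/-! ### The bounds for the uniform exponent -/

theorem IsRecordSeq.approxErr_pos {m : ℕ} (hm : 1 ≤ m) {ζ : ℝ} (hζ : Transcendental ℚ ζ)
    {q : ℕ → ℕ} (hq : IsRecordSeq (approxErr m ζ) q) (k : ℕ) : 0 < approxErr m ζ (q k) :=
  _root_.approxErr_pos hm hζ.irrational (hq.one_le k)

/-- The height inequality for the planes spanned by consecutive best approximations, in terms of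
upper bounds `a ≤ b` for the logarithms of `q (k + 1) * L (q k)` and `q (k + 2) * L (q (k + 1))`,
where `L` is the error. -/
theorem IsRecordSeq.exists_log_le {e : ℕ} {ζ : ℝ} (hζ : Transcendental ℚ ζ)
    {q : ℕ → ℕ} (hq : IsRecordSeq (approxErr (e + 2) ζ) q) : ∃ C : ℝ, ∀ K, ∃ k, K ≤ k ∧
      ∀ a b : ℝ, a ≤ b → Real.log (q (k + 1) * approxErr (e + 2) ζ (q k)) ≤ a →
        Real.log (q (k + 2) * approxErr (e + 2) ζ (q (k + 1))) ≤ b →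
        Real.log (q (k + 1)) ≤ 1 / ((e : ℝ) + 1) * a + b + C := by
  obtain ⟨C, hC⟩ := exists_logHeight_add_le e
  set A : ℝ := max 1 |ζ| ^ (e + 2) with hA
  have hA1 : 1 ≤ A := one_le_pow₀ (le_max_left _ _)
  have hpos := hq.approxErr_pos (by omega) hζ
  set x : ℕ → Fin (e + 3) → ℤ := fun k => approxPoint (e + 2) ζ (q k) with hx
  have hli : ∀ k, LinearIndependent ℚ ![toRat (x k), toRat (x (k + 1))] :=
    hq.linearIndependent hpos
  have hx0 : ∀ k, x k 0 = q k := fun k => by simp [hx, approxPoint]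
  have hplane : ∀ k, logHeight (Submodule.span ℚ {toRat (x k), toRat (x (k + 1))}) ≤
      Real.log (q (k + 1) * approxErr (e + 2) ζ (q k)) + Real.log (16 * A) := by
    intro k
    have hle : ∀ p, approxErr (e + 2) ζ p ≤ approxErr (e + 2) ζ (q k) →
        ∀ i : Fin (e + 3), |(approxPoint (e + 2) ζ p i : ℝ) -
          ζ ^ (i : ℕ) * (approxPoint (e + 2) ζ p 0 : ℤ)| ≤ approxErr (e + 2) ζ (q k) := by
      intro p hp i
      have h := (abs_sub_approxVec_le (Nat.lt_succ_iff.1 i.2) ζ p).trans hp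
      rw [abs_sub_comm] at h
      simpa [approxPoint] using h
    have h := logHeight_span_pair_le (x k) (x (k + 1)) 0 (fun i => ζ ^ (i : ℕ)) A
      (approxErr (e + 2) ζ (q k)) (hli k) hA1
      (fun i => abs_pow_le_max_pow (Nat.lt_succ_iff.1 i.2)) (hpos k) (approxErr_le_one _ _ _)
      (by rw [hx0]; exact_mod_cast hq.one_le k) (by rw [hx0]; exact_mod_cast hq.one_le (k + 1))
      (by rw [hx0, hx0]; exact_mod_cast (hq.strictMono (Nat.lt_succ_self k)).le)
      (hle (q k) le_rfl) (hle (q (k + 1)) (hq.anti k).le)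
    rw [hx0] at h
    exact_mod_cast h
  have hline : ∀ k, Real.log (q k) - Real.log 2 ≤ logHeight (Submodule.span ℚ {toRat (x k)}) := by
    intro k
    have h := le_logHeight_span_singleton (x k) 0
      (by rw [hx0]; exact_mod_cast hq.one_le k) (hq.one_le_abs_of_eq_smul hpos k)
    rw [hx0] at h
    exact_mod_cast h
  refine ⟨C + Real.log 2 + 2 * Real.log (16 * A), fun K => ?_⟩
  obtain ⟨k, hk⟩ := hC (fun k => x (k + K))
    (fun k => by have := hli (k + K); rwa [Nat.add_right_comm] at this)
    (fun j => by simpa only [Nat.add_assoc] using hq.span_eq_top hζ (j + K))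
  refine ⟨k + K, by omega, fun a b hab ha hb => ?_⟩
  simp only [show k + 1 + K = k + K + 1 by omega, show k + 2 + K = k + K + 2 by omega] at hk
  have h1 := (hplane (k + K)).trans (add_le_add_left ha _)
  have h2 := (hplane (k + K + 1)).trans (add_le_add_left hb _)
  have h3 := hline (k + K + 1)
  set P := logHeight (Submodule.span ℚ {toRat (x (k + K)), toRat (x (k + K + 1))})
  set R := logHeight (Submodule.span ℚ {toRat (x (k + K + 1)), toRat (x (k + K + 2))})
  have hlogA : 0 ≤ Real.log (16 * A) := Real.log_nonneg (by linarith)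
  set s : ℝ := 1 / ((e : ℝ) + 1) with hs
  have hs0 : 0 ≤ s := by positivity
  have hs1 : s ≤ 1 := by
    rw [hs, div_le_one (by positivity)]
    have : (0 : ℝ) ≤ e := by positivity
    linarith
  have hes : (e : ℝ) / (e + 1) = 1 - s := by rw [hs]; field_simp; ring
  rw [hes] at hk
  have h2' : R ≤ b + Real.log (16 * A) := h2
  rcases min_cases P R with ⟨hm, -⟩ | ⟨hm, -⟩ <;> rw [hm] at hk
  · have e1 : s * P ≤ s * (a + Real.log (16 * A)) := mul_le_mul_of_nonneg_left h1 hs0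
    nlinarith
  · have e1 : s * R ≤ s * (b + Real.log (16 * A)) := mul_le_mul_of_nonneg_left h2' hs0
    have e2 : (1 - s) * a ≤ (1 - s) * b := mul_le_mul_of_nonneg_left hab (by linarith)
    nlinarith

/-- The quadratic inequality for an exponent of uniform approximation above `1 / (n + 1)`. -/
theorem IsRecordSeq.quadratic_le {n : ℕ} (hn : 1 ≤ n) {ζ μ : ℝ} (hζ : Transcendental ℚ ζ)
    {q : ℕ → ℕ} (hq : IsRecordSeq (approxErr (2 * n) ζ) q) (hμ : 1 / ((n : ℝ) + 1) < μ)
    (hμ1 : μ ≤ 1) (hL : ∀ᶠ k in atTop, approxErr (2 * n) ζ (q k) ≤ (q (k + 1) : ℝ) ^ (-μ)) :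
    (n : ℝ) * μ ^ 2 + (2 * (n : ℝ) ^ 2 - 1) * μ - (2 * n - 1) ≤ 0 := by
  obtain ⟨C₁, hC₁, hH⟩ := hq.exists_one_le_mul hζ hμ hL
  have hpos := hq.approxErr_pos (by omega) hζ
  have hμ0 : 0 < μ := lt_trans (by positivity) hμ
  have hnR : (1 : ℝ) ≤ n := by exact_mod_cast hn
  obtain ⟨e, he⟩ : ∃ e, 2 * n = e + 2 := ⟨2 * n - 2, by omega⟩
  have heR : (e : ℝ) + 1 = 2 * n - 1 := by
    have : ((2 * n : ℕ) : ℝ) = (e + 2 : ℕ) := by rw [he]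
    push_cast at this
    linarith
  rw [he] at hq hL hH hpos
  obtain ⟨C₂, hC₂⟩ := hq.exists_log_le hζ
  obtain ⟨K, hK⟩ := eventually_atTop.1 (hL.and hH)
  have hq0 : ∀ k, (0 : ℝ) < q k := fun k => by exact_mod_cast hq.one_le k
  have hlogL : ∀ k, K ≤ k →
      Real.log (approxErr (e + 2) ζ (q k)) ≤ -μ * Real.log (q (k + 1)) := fun k hk => by
    have := Real.log_le_log (hpos k) (hK k hk).1
    rwa [Real.log_rpow (hq0 _)] at this
  have hmul : ∀ k, K ≤ k → Real.log (q (k + 1) * approxErr (e + 2) ζ (q k)) ≤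
      (1 - μ) * Real.log (q (k + 1)) := fun k hk => by
    rw [Real.log_mul (hq0 _).ne' (hpos k).ne']
    have := hlogL k hk
    linarith
  -- the nonvanishing of Hankel determinants bounds the growth of the denominators
  have hgrow : ∀ k, K ≤ k →
      n * (μ * Real.log (q (k + 1))) ≤ Real.log C₁ + Real.log (q k) := fun k hk => by
    have h1 := Real.log_le_log one_pos (hK k hk).2
    rw [Real.log_one, Real.log_mul hC₁.ne' (mul_pos (hq0 k) (pow_pos (hpos k) n)).ne',
      Real.log_mul (hq0 k).ne' (pow_pos (hpos k) n).ne', Real.log_pow] at h1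
    have h2 := mul_le_mul_of_nonneg_left (hlogL k hk) (by positivity : (0 : ℝ) ≤ n)
    linarith
  set s : ℝ := 1 / ((e : ℝ) + 1) with hs
  by_contra! hF
  set c : ℝ := n * μ - n * μ * (s * (1 - μ)) - (1 - μ) with hc
  have hcpos : 0 < c := by
    have h1 : (2 * (n : ℝ) - 1) * c = n * μ ^ 2 + (2 * (n : ℝ) ^ 2 - 1) * μ - (2 * n - 1) := by
      have h2 : (2 * (n : ℝ) - 1) * s = 1 := by
        rw [hs, heR]; exact mul_one_div_cancel (by linarith)
      have : (2 * (n : ℝ) - 1) * c = (2 * n - 1) * (n * μ) -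
          n * μ * ((2 * n - 1) * s * (1 - μ)) - (2 * n - 1) * (1 - μ) := by rw [hc]; ring
      rw [this, h2]; ring
    have h3 : 0 < (2 * (n : ℝ) - 1) * c := by rw [h1]; exact hF
    exact (pos_iff_pos_of_mul_pos h3).1 (by linarith)
  have hbound : ∀ K', K ≤ K' → ∃ k, K' ≤ k ∧
      c * Real.log (q (k + 1)) ≤ (1 - μ) * Real.log C₁ + n * μ * C₂ := by
    intro K' hK'
    obtain ⟨k, hk, h⟩ := hC₂ K'
    refine ⟨k, hk, ?_⟩
    have hmono : Real.log (q (k + 1)) ≤ Real.log (q (k + 1 + 1)) :=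
      Real.log_le_log (hq0 _) (by exact_mod_cast (hq.strictMono (Nat.lt_succ_self (k + 1))).le)
    have h1 := h _ _ (mul_le_mul_of_nonneg_left hmono (by linarith : 0 ≤ 1 - μ))
      (hmul k (by omega)) (hmul (k + 1) (by omega))
    have h2 := hgrow (k + 1) (by omega)
    have h3 := mul_le_mul_of_nonneg_left h1 (by positivity : 0 ≤ (n : ℝ) * μ)
    have h4 := mul_le_mul_of_nonneg_left h2 (by linarith : 0 ≤ 1 - μ)
    rw [hc]
    linarith
  have hqt : Tendsto (fun k => c * Real.log (q (k + 1))) atTop atTop :=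
    (Real.tendsto_log_atTop.comp (tendsto_natCast_atTop_atTop.comp
      ((tendsto_add_atTop_iff_nat 1).2 hq.strictMono.tendsto_atTop))).const_mul_atTop hcpos
  obtain ⟨K', hK'⟩ := eventually_atTop.1
    (hqt.eventually_gt_atTop ((1 - μ) * Real.log C₁ + n * μ * C₂))
  obtain ⟨k, hk, h⟩ := hbound (max K K') (le_max_left _ _)
  exact absurd h (not_le.2 (hK' k ((le_max_right _ _).trans hk)))

theorem exists_isRecordSeq_approxErr {m : ℕ} (hm : 1 ≤ m) {ζ l : ℝ} (hζ : Transcendental ℚ ζ)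
    (hl : 0 < l) (h : ∀ᶠ X : ℝ in atTop, SimApproxSolvable m ζ l X) :
    ∃ q, IsRecordSeq (approxErr m ζ) q := by
  refine exists_isRecordSeq _ (fun p hp => approxErr_pos hm hζ.irrational hp) fun ε hε => ?_
  have h1 := (tendsto_rpow_neg_atTop hl).eventually_lt_const hε
  obtain ⟨X, hX1, hX2⟩ := (h.and h1).exists
  obtain ⟨p, hp, -, hpε⟩ := hX1.exists_approxErr_le
  exact ⟨p, hp, hpε.trans_lt hX2⟩

/-- If the Hankel lower bound holds for all large best approximations, then no exponent above
`1 / n` is attained for arbitrarily large `X`. -/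
theorem IsRecordSeq.not_frequently {n : ℕ} (hn : 1 ≤ n) {ζ l C : ℝ} (hζ : Transcendental ℚ ζ)
    {q : ℕ → ℕ} (hq : IsRecordSeq (approxErr (2 * n) ζ) q) (hC : 0 < C)
    (hH : ∀ᶠ k in atTop, 1 ≤ C * (q k * approxErr (2 * n) ζ (q k) ^ n))
    (hl : 1 / (n : ℝ) < l) : ¬ ∃ᶠ X : ℝ in atTop, SimApproxSolvable (2 * n) ζ l X := by
  rw [Filter.not_frequently]
  have hnR : (0 : ℝ) < n := by exact_mod_cast hn
  have hl0 : 0 < l := lt_trans (by positivity) hl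
  have hexp : 1 - l * n < 0 := by
    rw [div_lt_iff₀ hnR] at hl
    linarith
  have hpos := hq.approxErr_pos (by omega) hζ
  obtain ⟨K, hK⟩ := eventually_atTop.1 hH
  filter_upwards [eventually_gt_atTop 0, (tendsto_rpow_neg_atTop hl0).eventually_lt_const (hpos K),
    eventually_mul_rpow_lt (C := C) hexp one_pos] with X hX0 hX1 hX2 hX
  obtain ⟨p, hp1, hpX, hp⟩ := hX.exists_approxErr_le
  have hex : ∃ j, p < q (j + 1) :=
    ⟨p, (Nat.lt_succ_self p).trans_le (hq.strictMono.id_le (p + 1))⟩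
  classical
  set j := Nat.find hex with hj
  have hjp : p < q (j + 1) := Nat.find_spec hex
  have hpj : q j ≤ p := by
    rcases Nat.eq_zero_or_pos j with h | h
    · rw [h, hq.zero]; exact hp1
    · have := Nat.find_min hex (m := j - 1) (by omega)
      rw [Nat.sub_add_cancel h] at this
      omega
  have hjK : K ≤ j := by
    by_contra! hlt
    have h1 : p < q K := hjp.trans_le (hq.strictMono.monotone hlt)
    exact absurd (hq.lt_of_lt K p hp1 h1) (not_lt.2 (hp.trans hX1.le))
  have h1 := (hq.le_of_lt j p hp1 hjp).trans hp
  have h2 : (q j : ℝ) ≤ X := le_trans (by exact_mod_cast hpj) hpX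
  have h3 := hK j hjK
  have hL0 := (hpos j).le
  have h4 : C * (q j * approxErr (2 * n) ζ (q j) ^ n) ≤ C * X ^ (1 - l * n) := by
    calc C * (q j * approxErr (2 * n) ζ (q j) ^ n) ≤ C * (X * (X ^ (-l)) ^ n) := by gcongr
      _ = C * X ^ (1 - l * n) := by
        rw [← Real.rpow_natCast, ← Real.rpow_mul hX0.le, neg_mul, sub_eq_add_neg,
          Real.rpow_add hX0, Real.rpow_one]
  linarith

theorem exists_of_lt_lambdaHatExp {m : ℕ} {ζ r : ℝ} (h : (r : EReal) < lambdaHatExp m ζ) :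
    ∃ l : ℝ, r < l ∧ ∀ᶠ X : ℝ in atTop, SimApproxSolvable m ζ l X := by
  obtain ⟨_, ⟨l, rfl, hl⟩, hr⟩ := lt_sSup_iff.1 h
  exact ⟨l, EReal.coe_lt_coe_iff.1 hr, hl⟩

theorem exists_of_lt_lambdaExp {m : ℕ} {ζ r : ℝ} (h : (r : EReal) < lambdaExp m ζ) :
    ∃ l : ℝ, r < l ∧ ∃ᶠ X : ℝ in atTop, SimApproxSolvable m ζ l X := by
  obtain ⟨_, ⟨l, rfl, hl⟩, hr⟩ := lt_sSup_iff.1 h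
  exact ⟨l, EReal.coe_lt_coe_iff.1 hr, hl⟩

theorem lambdaHatExp_le_one_div {n : ℕ} (hn : 1 ≤ n) {ζ : ℝ} (hζ : Transcendental ℚ ζ)
    (h : ((1 / (n : ℝ) : ℝ) : EReal) < lambdaExp (2 * n) ζ) :
    lambdaHatExp (2 * n) ζ ≤ ((1 / ((n : ℝ) + 1) : ℝ) : EReal) := by
  by_contra! hcon
  obtain ⟨l, hl, hsolv⟩ := exists_of_lt_lambdaHatExp hcon
  obtain ⟨l', hl', hfreq⟩ := exists_of_lt_lambdaExp h
  obtain ⟨μ, hμ, hμl⟩ := exists_between hl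
  have hl0 : 0 < l := lt_trans (by positivity) hl
  obtain ⟨q, hq⟩ := exists_isRecordSeq_approxErr (by omega) hζ hl0 hsolv
  obtain ⟨C, hC, hH⟩ := hq.exists_one_le_mul hζ hμ (hq.eventually_le_rpow hμl hsolv)
  exact hq.not_frequently hn hζ hC hH hl' hfreq

/-- The positive root of `n * μ ^ 2 + (2 * n ^ 2 - 1) * μ - (2 * n - 1)`. -/
noncomputable def uniformBound (n : ℕ) : ℝ :=
  Real.sqrt (((n : ℝ) + 1 / (2 * (n : ℝ))) ^ 2 - 1 / (n : ℝ)) - (n : ℝ) + 1 / (2 * (n : ℝ))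

theorem mul_sub_eq_quadratic {n : ℕ} (hn : 1 ≤ n) (μ : ℝ) :
    (n : ℝ) * ((μ + n - 1 / (2 * (n : ℝ))) ^ 2 -
      (((n : ℝ) + 1 / (2 * (n : ℝ))) ^ 2 - 1 / (n : ℝ))) =
      n * μ ^ 2 + (2 * (n : ℝ) ^ 2 - 1) * μ - (2 * n - 1) := by
  have : (n : ℝ) ≠ 0 := by positivity
  field_simp
  ring

theorem le_uniformBound {n : ℕ} (hn : 1 ≤ n) {μ : ℝ}
    (h : (n : ℝ) * μ ^ 2 + (2 * (n : ℝ) ^ 2 - 1) * μ - (2 * n - 1) ≤ 0) :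
    μ ≤ uniformBound n := by
  have hnR : (0 : ℝ) < n := by exact_mod_cast hn
  rw [← mul_sub_eq_quadratic hn, mul_nonpos_iff_pos_imp_nonpos] at h
  have h1 := Real.le_sqrt_of_sq_le (sub_nonpos.1 (h.1 hnR))
  rw [uniformBound]
  linarith

theorem one_div_lt_uniformBound {n : ℕ} (hn : 1 ≤ n) : 1 / ((n : ℝ) + 1) < uniformBound n := by
  have hnR : (1 : ℝ) ≤ n := by exact_mod_cast hn
  have h1 : (n : ℝ) * (1 / ((n : ℝ) + 1)) ^ 2 + (2 * (n : ℝ) ^ 2 - 1) * (1 / ((n : ℝ) + 1)) -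
      (2 * n - 1) = -(n / ((n : ℝ) + 1)) ^ 2 := by
    field_simp
    ring
  have h2 : 0 < (n / ((n : ℝ) + 1)) ^ 2 := by positivity
  rw [← mul_sub_eq_quadratic hn] at h1
  have h3 : (1 / ((n : ℝ) + 1) + n - 1 / (2 * (n : ℝ))) ^ 2 <
      ((n : ℝ) + 1 / (2 * (n : ℝ))) ^ 2 - 1 / (n : ℝ) := by
    by_contra! hcon
    have := mul_nonneg (by linarith : (0 : ℝ) ≤ n) (sub_nonneg.2 hcon)
    linarith
  have h4 := Real.lt_sqrt_of_sq_lt h3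
  rw [uniformBound]
  linarith

theorem uniformBound_lt_one {n : ℕ} (hn : 1 ≤ n) : uniformBound n < 1 := by
  have hnR : (1 : ℝ) ≤ n := by exact_mod_cast hn
  have h1 := mul_sub_eq_quadratic hn 1
  have h2 : ((n : ℝ) + 1 / (2 * (n : ℝ))) ^ 2 - 1 / (n : ℝ) <
      (1 + n - 1 / (2 * (n : ℝ))) ^ 2 := by
    by_contra! hcon
    have := mul_nonneg (by linarith : (0 : ℝ) ≤ n) (sub_nonneg.2 hcon)
    nlinarith
  have h3 : 0 < 1 + n - 1 / (2 * (n : ℝ)) := by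
    have : 1 / (2 * (n : ℝ)) ≤ 1 := by rw [div_le_one (by positivity)]; linarith
    linarith
  have h4 := (Real.sqrt_lt' h3).2 h2
  rw [uniformBound]
  linarith

theorem lambdaHatExp_le_uniformBound {n : ℕ} (hn : 1 ≤ n) {ζ : ℝ} (hζ : Transcendental ℚ ζ) :
    lambdaHatExp (2 * n) ζ ≤ (uniformBound n : EReal) := by
  by_contra! hcon
  obtain ⟨l, hl, hsolv⟩ := exists_of_lt_lambdaHatExp hcon
  obtain ⟨μ, hμ, hμl⟩ := exists_between (lt_min hl (uniformBound_lt_one hn))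
  have hμ' := (one_div_lt_uniformBound hn).trans hμ
  have hl0 : 0 < l := lt_trans (by positivity) ((one_div_lt_uniformBound hn).trans hl)
  obtain ⟨q, hq⟩ := exists_isRecordSeq_approxErr (by omega) hζ hl0 hsolv
  have hquad := hq.quadratic_le hn hζ hμ' (hμl.le.trans (min_le_right _ _))
    (hq.eventually_le_rpow (hμl.trans_le (min_le_left _ _)) hsolv)
  exact absurd (le_uniformBound hn hquad) (not_le.2 hμ)

theorem uniformBound_one : uniformBound 1 = (Real.sqrt 5 - 1) / 2 := by
  have h : (((1 : ℕ) : ℝ) + 1 / (2 * ((1 : ℕ) : ℝ))) ^ 2 - 1 / ((1 : ℕ) : ℝ) = 5 / 2 ^ 2 := by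
    norm_num
  rw [uniformBound, h, Real.sqrt_div' _ (by positivity), Real.sqrt_sq (by norm_num)]
  push_cast
  ring

theorem uniformBound_two : uniformBound 2 = (Real.sqrt 73 - 7) / 4 := by
  have h : (((2 : ℕ) : ℝ) + 1 / (2 * ((2 : ℕ) : ℝ))) ^ 2 - 1 / ((2 : ℕ) : ℝ) = 73 / 4 ^ 2 := by
    norm_num
  rw [uniformBound, h, Real.sqrt_div' _ (by positivity), Real.sqrt_sq (by norm_num)]
  push_cast
  ring

theorem theorem4p2 (ζ : ℝ) (hζ : Transcendental ℚ ζ) :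
    (∀ n : ℕ, 1 ≤ n →
      lambdaHatExp (2 * n) ζ ≤
        ((Real.sqrt (((n : ℝ) + 1 / (2 * (n : ℝ))) ^ 2 - 1 / (n : ℝ)) - (n : ℝ)
          + 1 / (2 * (n : ℝ)) : ℝ) : EReal) ∧
      (((1 / (n : ℝ) : ℝ) : EReal) < lambdaExp (2 * n) ζ →
        lambdaHatExp (2 * n) ζ ≤ ((1 / ((n : ℝ) + 1) : ℝ) : EReal)) ∧
      1 / ((n : ℝ) + 1) <
        Real.sqrt (((n : ℝ) + 1 / (2 * (n : ℝ))) ^ 2 - 1 / (n : ℝ)) - (n : ℝ)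
          + 1 / (2 * (n : ℝ))) ∧
    lambdaHatExp 2 ζ ≤ (((Real.sqrt 5 - 1) / 2 : ℝ) : EReal) ∧
    lambdaHatExp 4 ζ ≤ (((Real.sqrt 73 - 7) / 4 : ℝ) : EReal) := by
  refine ⟨fun n hn => ⟨lambdaHatExp_le_uniformBound hn hζ, lambdaHatExp_le_one_div hn hζ,
    one_div_lt_uniformBound hn⟩, ?_, ?_⟩
  · rw [← uniformBound_one]
    exact lambdaHatExp_le_uniformBound le_rfl hζ
  · rw [← uniformBound_two]
    exact lambdaHatExp_le_uniformBound one_le_two hζ
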